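/- **Setting.** Let $\Gamma^l,\Gamma^r\subset\mathbb R^2$ be fixed simple curves, each connecting $(0,1)$ and $(0,-1)$, let $R_0\ge 1$, and for every $R\ge R_0$ let $\Omega_R\subset\mathbb R^2$ be a bounded domain with Lipschitz boundary $$\partial\Omega_R=\Gamma_R^+\cup\Gamma_R^-\cup\Gamma_R^l\cup\Gamma_R^r,\qquad \Gamma_R^\pm=[-R,R]\times\{\pm1\},\quad \Gamma_R^l=\Gamma^l+(-R,0),\quad \Gamma_R^r=\Gamma^r+(R,0),$$ where $\Gamma_R^l\cup\Gamma_R^r$ meets $\Gamma_R^+\cup\Gamma_R^-$ only at the points $(\pm R,\pm1)$. (Example: $\Omega_R=(-R,R)\times(-1,1)$.) Let $ds$ be arc length and $\nu_y$ the outward unit normal on $\partial\Omega_R$ (defined almost everywhere). The Neumann–Poincaré operator is $$\mathcal K_R[\varphi](x)=\mathrm{p.v.}\,\frac1{2\pi}\int_{\partial\Omega_R}\frac{\langle y-x,\nu_y\rangle}{|x-y|^2}\,\varphi(y)\,ds(y),\qquad x\in\partial\Omega_R,$$ where the principal value is the limit as $\varepsilon\to0^+$ of the integrals over $\{y\in\partial\Omega_R:|x-y|\ge\varepsilon\}$,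 and $H^{1/2}(\partial\Omega_R)$ is the space of measurable $h:\partial\Omega_R\to\mathbb C$ with finite norm $$\|h\|_{H^{1/2}(\partial\Omega_R)}=\Big(\int_{\partial\Omega_R}|h|^2\,ds+\int_{\partial\Omega_R}\int_{\partial\Omega_R}\frac{|h(x)-h(z)|^2}{|x-z|^2}\,ds(x)\,ds(z)\Big)^{1/2}.$$ **Proposition 3.1.** Let $\lambda\in(0,1/2]$. There are functions $\varphi_R\in H^{1/2}(\partial\Omega_R)$, $R\ge R_0$, with $\|\varphi_R\|_{H^{1/2}(\partial\Omega_R)}\neq0$, such that for every $R\ge R_0$ the principal value $\mathcal K_R[\varphi_R](x)$ exists for almost every $x\in\partial\Omega_R$ and $(\lambda I-\mathcal K_R)[\varphi_R]\in H^{1/2}(\partial\Omega_R)$, and $$\lim_{R\to\infty}\frac{\|(\lambda I-\mathcal K_R)[\varphi_R]\|_{H^{1/2}(\partial\Omega_R)}}{\|\varphi_R\|_{H^{1/2}(\partial\Omega_R)}}=0.$$ -/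

import Mathlib

open MeasureTheory Filter Topology
open scoped ENNReal NNReal

namespace ThinNP

/-- The Euclidean plane. -/
abbrev Plane : Type := EuclideanSpace ℝ (Fin 2)

/-! ### Lipschitz domains, arc length, outward normal -/

/-- A bounded planar Lipschitz domain: a bounded, connected (nonempty) open set which near each of
its boundary points `p` is, in a Cartesian coordinate system centred at `p`, the region below the
graph of a Lipschitz function. -/
structure IsBoundedLipschitzDomain (Ω : Set Plane) : Prop where
  isOpen : IsOpen Ω
  isConnected : IsConnected Ω
  isBounded : Bornology.IsBounded Ω
  local_graph : ∀ p ∈ frontier Ω, ∃ (T : Plane ≃ₗᵢ[ℝ] Plane) (g : ℝ → ℝ) (L : ℝ≥0) (r : ℝ),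
    LipschitzWith L g ∧ 0 < r ∧
      ∀ x ∈ Metric.ball p r, x ∈ Ω ↔ (T (x - p)) 1 < g ((T (x - p)) 0)

/-- The line element on `∂Ω`: one-dimensional Hausdorff measure (arc length) restricted
to `∂Ω`. -/
noncomputable def arcLength (Ω : Set Plane) : Measure Plane :=
  (Measure.hausdorffMeasure 1).restrict (frontier Ω)

/-- `ν` is the outward unit normal of `Ω` at `y`: however thin a double cone around the line
orthogonal to `ν` is removed, close to `y` the part on the side of `ν` lies outside `Ω` and the part
on the other side lies in `Ω`. At a boundary point where the graph function of a Lipschitz domain is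
differentiable this is the usual outward normal. -/
def IsOutwardUnitNormal (Ω : Set Plane) (y ν : Plane) : Prop :=
  ‖ν‖ = 1 ∧ ∀ ε : ℝ, 0 < ε → ∀ᶠ z in 𝓝 y,
    (ε * ‖z - y‖ < inner ℝ (z - y) ν → z ∉ Ω) ∧
    (inner ℝ (z - y) ν < -(ε * ‖z - y‖) → z ∈ Ω)

open Classical in
/-- The outward unit normal `ν_y` (unique where it exists; for a Lipschitz domain it exists at
almost every boundary point), and `0` at points without a normal. -/
noncomputable def outwardNormal (Ω : Set Plane) (y : Plane) : Plane :=
  if h : ∃ ν, IsOutwardUnitNormal Ω y ν then h.choose else 0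

/-! ### The Neumann–Poincaré operator -/

/-- The integral kernel `k(x,y) = (1/2π) ⟨y - x, ν_y⟩ / |x - y|²`. -/
noncomputable def npKernel (Ω : Set Plane) (x y : Plane) : ℝ :=
  1 / (2 * Real.pi) * (inner ℝ (y - x) (outwardNormal Ω y) / ‖x - y‖ ^ 2)

/-- The truncated integral `∫_{y ∈ ∂Ω, |x - y| ≥ ε} k(x,y) φ(y) ds(y)`. -/
noncomputable def npTrunc (Ω : Set Plane) (φ : Plane → ℂ) (x : Plane) (ε : ℝ) : ℂ :=
  ∫ y in {y | ε ≤ dist x y}, (npKernel Ω x y : ℂ) * φ y ∂(arcLength Ω)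

/-- The principal value integral defining `K_{∂Ω}[φ](x)` exists: the truncated integrals converge
absolutely, and they have a limit as `ε → 0+`. -/
def NPExists (Ω : Set Plane) (φ : Plane → ℂ) (x : Plane) : Prop :=
  (∀ ε : ℝ, 0 < ε →
    IntegrableOn (fun y => (npKernel Ω x y : ℂ) * φ y) {y | ε ≤ dist x y} (arcLength Ω)) ∧
  ∃ l : ℂ, Tendsto (npTrunc Ω φ x) (𝓝[>] 0) (𝓝 l)

/-- The Neumann–Poincaré operator `K_{∂Ω}[φ](x) = p.v. ∫_{∂Ω} k(x,y) φ(y) ds(y)`. -/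
noncomputable def npOperator (Ω : Set Plane) (φ : Plane → ℂ) (x : Plane) : ℂ :=
  limUnder (𝓝[>] 0) (npTrunc Ω φ x)

/-! ### The space `H^{1/2}(∂Ω)` -/

/-- `‖h‖_{H^{1/2}(∂Ω)} = (∫ |h(x)|² ds(x) + ∫∫ |h(x) - h(z)|² / |x - z|² ds(x) ds(z))^{1/2}`,
with value `∞` when an integral diverges. Only the values of `h` on `∂Ω` matter. -/
noncomputable def hHalfNorm (Ω : Set Plane) (h : Plane → ℂ) : ℝ≥0∞ :=
  ((∫⁻ x, ‖h x‖ₑ ^ 2 ∂(arcLength Ω)) +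
    ∫⁻ x, ∫⁻ z, ‖h x - h z‖ₑ ^ 2 / edist x z ^ 2 ∂(arcLength Ω) ∂(arcLength Ω)) ^ (1 / 2 : ℝ)

/-- `h ∈ H^{1/2}(∂Ω)`. -/
def MemHHalf (Ω : Set Plane) (h : Plane → ℂ) : Prop :=
  AEStronglyMeasurable h (arcLength Ω) ∧ hHalfNorm Ω h < ∞

/-! ### Thin domains -/

/-- `Γ` is a simple curve connecting `a` and `b`. -/
def IsSimpleCurve (Γ : Set Plane) (a b : Plane) : Prop :=
  ∃ γ : Path a b, Function.Injective γ ∧ Set.range γ = Γ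

/-- The long sides `Γ_R^+ ∪ Γ_R^- = [-R,R] × {1} ∪ [-R,R] × {-1}`. -/
def longSides (R : ℝ) : Set Plane :=
  {x | |x 0| ≤ R ∧ x 1 = 1} ∪ {x | |x 0| ≤ R ∧ x 1 = -1}

/-- The short sides `Γ_R^s`: the fixed curve `Γl` translated by `(-R, 0)` and the fixed curve `Γr`
translated by `(R, 0)`. -/
noncomputable def shortSides (Γl Γr : Set Plane) (R : ℝ) : Set Plane :=
  (fun x => x + !₂[-R, 0]) '' Γl ∪ (fun x => x + !₂[R, 0]) '' Γr

/-- `Ω` is the thin domain `Ω_R` with short sides of shape `Γl` and `Γr`: a bounded Lipschitz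
domain whose boundary consists of the long sides and the short sides, which meet only at the corner
points `(±R, ±1)`. -/
structure IsThinDomain (Γl Γr : Set Plane) (R : ℝ) (Ω : Set Plane) : Prop where
  lipschitz : IsBoundedLipschitzDomain Ω
  frontier_eq : frontier Ω = longSides R ∪ shortSides Γl Γr R
  inter_subset : longSides R ∩ shortSides Γl Γr R ⊆
    {!₂[R, 1], !₂[R, -1], !₂[-R, 1], !₂[-R, -1]}

end ThinNP

namespace ThinNP

/-! ### Coordinates in the plane -/

/-! The long sides look like an infinite strip, and the proof transplants generalized eigenfunctions
of the strip. On a straight side the kernel vanishes, because `y - x` is orthogonal to the normal.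
If both lines carry the same profile, each acts on the other by convolution with `stripKernel s = 1
/ (π (4 + s²))`. The symbol of this convolution is continuous, equals `1/2` at frequency `0` and
tends to `0` at infinity, so `λ` is attained at some frequency `ξ`
(`exists_integral_stripKernel_mul_wave_eq`), and the wave `e^{iξt}` on both lines solves the
equation exactly.

For large `R = 2w` the wave is cut off by a tent of half-width `w` on both long sides. On the long
sides the residual is a commutator of the convolution with the tent (`packet_residual_eq`). It is
`O(w^{-3/4})`, both in sup norm and as a Lipschitz constant, because the kernel has a finite
`3/4`-moment. The short sides lie at distance at least `w/2` from the support, and there the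
potential and its Lipschitz constant are `O(1/w)`. A function on a curve of length `m ≥ 1` that is
bounded by `L` and `L`-Lipschitz has `H^{1/2}` norm at most `2Lm` (`hHalfNorm_le`). Since `m =
O(w)`, the residual has norm `O(w^{1/4})`, while the packet has norm at least `(w/4)^{1/2}`
(`le_hHalfNorm`). The quotient is `O(w^{-1/4})` (`IsThinDomain.exists_quasimode`).

For the remaining `R` any admissible density will do. A small tent near `(0, 1)` serves, since the
boundary is flat there and the short sides stay away (`IsThinDomain.exists_isAdmissible`). -/

theorem dist_sq_eq (x y : Plane) : dist x y ^ 2 = (x 0 - y 0) ^ 2 + (x 1 - y 1) ^ 2 := by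
  rw [EuclideanSpace.dist_eq, Real.sq_sqrt (by positivity), Fin.sum_univ_two, Real.dist_eq,
    Real.dist_eq, sq_abs, sq_abs]

theorem norm_sq_eq (x : Plane) : ‖x‖ ^ 2 = x 0 ^ 2 + x 1 ^ 2 := by
  rw [EuclideanSpace.real_norm_sq_eq, Fin.sum_univ_two]

theorem inner_eq (x y : Plane) : inner ℝ x y = x 0 * y 0 + x 1 * y 1 := by
  rw [PiLp.inner_apply, Fin.sum_univ_two]; simp; ring

theorem abs_coord_sub_le_dist (x y : Plane) (i : Fin 2) : |x i - y i| ≤ dist x y := by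
  rw [dist_eq_norm]; exact PiLp.norm_apply_le (x - y) i

theorem continuous_coord (i : Fin 2) : Continuous fun x : Plane => x i := by fun_prop

/-- The horizontal line at height `h`, parametrised by arc length. -/
noncomputable def horizontal (h t : ℝ) : Plane := !₂[t, h]

@[simp] theorem horizontal_zero (h t : ℝ) : horizontal h t 0 = t := by simp [horizontal]

@[simp] theorem horizontal_one (h t : ℝ) : horizontal h t 1 = h := by simp [horizontal]

theorem eq_horizontal (x : Plane) : x = horizontal (x 1) (x 0) := by
  ext i; fin_cases i <;> simp

theorem isometry_horizontal (h : ℝ) : Isometry (horizontal h) := by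
  refine Isometry.of_dist_eq fun s t => ?_
  rw [← abs_of_nonneg (dist_nonneg (x := horizontal h s)),
    ← abs_of_nonneg (dist_nonneg (x := s)), ← sq_eq_sq_iff_abs_eq_abs, dist_sq_eq, Real.dist_eq]
  simp

theorem map_horizontal_volume (h : ℝ) :
    Measure.map (horizontal h) volume =
      (Measure.hausdorffMeasure 1).restrict (Set.range (horizontal h)) := by
  rw [← hausdorffMeasure_real,
    (isometry_horizontal h).map_hausdorffMeasure (Or.inl zero_le_one)]

theorem measurableEmbedding_horizontal (h : ℝ) : MeasurableEmbedding (horizontal h) :=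
  (isometry_horizontal h).isClosedEmbedding.measurableEmbedding

theorem restrict_horizontal_image (h : ℝ) (s : Set ℝ) :
    (Measure.hausdorffMeasure 1).restrict (horizontal h '' s) =
      Measure.map (horizontal h) (volume.restrict s) := by
  have := (measurableEmbedding_horizontal h).restrict_map volume (horizontal h '' s)
  rw [Set.preimage_image_eq _ (isometry_horizontal h).injective, map_horizontal_volume,
    Measure.restrict_restrict_of_subset (Set.image_subset_range _ _)] at this
  exact this

theorem hausdorffMeasure_horizontal_image (h : ℝ) (s : Set ℝ) :
    Measure.hausdorffMeasure 1 (horizontal h '' s) = volume s := by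
  rw [(isometry_horizontal h).hausdorffMeasure_image (Or.inl zero_le_one), hausdorffMeasure_real]

/-! ### Finite length of the boundary of a Lipschitz domain -/

theorem IsBoundedLipschitzDomain.isCompact_frontier {Ω : Set Plane}
    (hΩ : IsBoundedLipschitzDomain Ω) : IsCompact (frontier Ω) :=
  Metric.isCompact_of_isClosed_isBounded isClosed_frontier
    (hΩ.isBounded.closure.subset frontier_subset_closure)

/-- By compactness the claim is local, and near `p` the frontier lies in the image of `(-r, r)`
under a Lipschitz graph map. -/
theorem IsBoundedLipschitzDomain.hausdorffMeasure_frontier_lt_top {Ω : Set Plane}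
    (hΩ : IsBoundedLipschitzDomain Ω) : Measure.hausdorffMeasure 1 (frontier Ω) < ∞ := by
  refine hΩ.isCompact_frontier.measure_lt_top_of_nhdsWithin fun p hp => ?_
  obtain ⟨T, g, L, r, hg, hr, hloc⟩ := hΩ.local_graph p hp
  refine ⟨frontier Ω ∩ Metric.ball p r,
    inter_mem self_mem_nhdsWithin (mem_nhdsWithin_of_mem_nhds (Metric.ball_mem_nhds p hr)), ?_⟩
  have hG : LipschitzWith (1 + L) fun s : ℝ => T.symm (horizontal (g s) s) + p := by
    refine LipschitzWith.of_dist_le_mul fun s t => ?_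
    rw [dist_add_right, T.symm.dist_map]
    have h1 : dist (horizontal (g s) s) (horizontal (g t) t) ≤ dist s t + dist (g s) (g t) := by
      refine abs_le_of_sq_le_sq' ?_ (by positivity) |>.2
      rw [dist_sq_eq, Real.dist_eq, Real.dist_eq]
      simp only [horizontal_zero, horizontal_one]
      nlinarith [sq_abs (s - t), sq_abs (g s - g t), abs_nonneg (s - t), abs_nonneg (g s - g t),
        mul_nonneg (abs_nonneg (s - t)) (abs_nonneg (g s - g t))]
    have h2 := hg.dist_le_mul s t
    push_cast
    linarith
  have hsub : frontier Ω ∩ Metric.ball p r ⊆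
      (fun s : ℝ => T.symm (horizontal (g s) s) + p) '' Set.Ioo (-r) r := by
    rintro x ⟨hx, hxr⟩
    have hxn : x ∉ Ω := by rw [hΩ.isOpen.frontier_eq] at hx; exact hx.2
    -- A frontier point is on the graph: below it the point would belong to the open set `Ω`;
    -- strictly above it a whole neighbourhood would miss `Ω`.
    have hle : g ((T (x - p)) 0) ≤ (T (x - p)) 1 := not_lt.1 fun h => hxn ((hloc x hxr).2 h)
    have hge : (T (x - p)) 1 ≤ g ((T (x - p)) 0) := by
      by_contra! hlt
      have hc0 : Continuous fun z : Plane => g ((T (z - p)) 0) :=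
        hg.continuous.comp ((continuous_coord 0).comp (by fun_prop))
      have hc1 : Continuous fun z : Plane => (T (z - p)) 1 :=
        (continuous_coord 1).comp (by fun_prop)
      have hev : ∀ᶠ z in 𝓝 x, z ∉ Ω := by
        filter_upwards [hc0.continuousAt.eventually_lt hc1.continuousAt hlt,
          Metric.isOpen_ball.mem_nhds hxr] with z hz hzr hzΩ
        exact absurd ((hloc z hzr).1 hzΩ) (not_lt.2 hz.le)
      obtain ⟨z, hz, hz'⟩ :=
        ((mem_closure_iff_frequently.1 (frontier_subset_closure hx)).and_eventually hev).exists
      exact hz' hz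
    refine ⟨(T (x - p)) 0, ?_, ?_⟩
    · have h1 : |(T (x - p)) 0| ≤ ‖T (x - p)‖ := PiLp.norm_apply_le (T (x - p)) 0
      rw [T.norm_map, ← dist_eq_norm] at h1
      exact abs_lt.1 (h1.trans_lt hxr)
    · simp only
      rw [le_antisymm hle hge, ← eq_horizontal, T.symm_apply_apply, sub_add_cancel]
  refine (measure_mono hsub).trans_lt ((hG.hausdorffMeasure_image_le zero_le_one _).trans_lt ?_)
  rw [hausdorffMeasure_real, Real.volume_Ioo]
  exact ENNReal.mul_lt_top (by simp) ENNReal.ofReal_lt_top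

/-! ### The outward normal along a flat piece of the boundary -/

/-- A connected set missing the frontier cannot meet both `Ω` and the exterior. -/
theorem subset_or_disjoint_of_convex {Ω U : Set Plane} (hΩ : IsOpen Ω) (hU : Convex ℝ U)
    (hd : ∀ x ∈ U, x ∉ frontier Ω) : (∀ x ∈ U, x ∈ Ω) ∨ ∀ x ∈ U, x ∉ Ω := by
  by_contra! hcon
  obtain ⟨⟨a, haU, ha⟩, b, hbU, hb⟩ := hcon
  have hcover : U ⊆ Ω ∪ (closure Ω)ᶜ := fun x hx => by
    by_cases h : x ∈ Ω
    · exact Or.inl h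
    · refine Or.inr fun hc => hd x hx ?_
      rw [hΩ.frontier_eq]; exact ⟨hc, h⟩
  obtain ⟨z, -, hz, hz'⟩ := hU.isPreconnected Ω (closure Ω)ᶜ hΩ isClosed_closure.isOpen_compl
    hcover ⟨b, hbU, hb⟩ ⟨a, haU, (hcover haU).resolve_left ha⟩
  exact hz' (subset_closure hz)

/-- Along any direction `v` making an acute angle with an outward normal, one leaves the domain,
and along `-v` one enters it. -/
theorem IsOutwardUnitNormal.eventually_ray {Ω : Set Plane} {y ν v : Plane}
    (h : IsOutwardUnitNormal Ω y ν) (hv : 0 < inner ℝ v ν) :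
    ∀ᶠ s : ℝ in 𝓝[>] 0, y + s • v ∉ Ω ∧ y - s • v ∈ Ω := by
  have hv0 : 0 < ‖v‖ := norm_pos_iff.2 fun h0 => by simp [h0] at hv
  set ε : ℝ := inner ℝ v ν / (2 * ‖v‖) with hε
  have hε0 : 0 < ε := by positivity
  have hεv : ε * ‖v‖ < inner ℝ v ν := by rw [hε]; field_simp; linarith
  have key := h.2 ε hε0
  have t1 : Tendsto (fun s : ℝ => y + s • v) (𝓝[>] 0) (𝓝 y) := by
    have : Continuous fun s : ℝ => y + s • v := by fun_prop
    simpa using (this.tendsto 0).mono_left nhdsWithin_le_nhds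
  have t2 : Tendsto (fun s : ℝ => y - s • v) (𝓝[>] 0) (𝓝 y) := by
    have : Continuous fun s : ℝ => y - s • v := by fun_prop
    simpa using (this.tendsto 0).mono_left nhdsWithin_le_nhds
  filter_upwards [t1.eventually key, t2.eventually key, self_mem_nhdsWithin] with s h1 h2 hs
  have hs : 0 < s := hs
  constructor
  · refine h1.1 ?_
    rw [add_sub_cancel_left, norm_smul, inner_smul_left, Real.norm_of_nonneg hs.le]
    simp only [conj_trivial]
    nlinarith
  · refine h2.2 ?_
    rw [show y - s • v - y = -(s • v) by abel, norm_neg, inner_neg_left, norm_smul,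
      inner_smul_left, Real.norm_of_nonneg hs.le]
    simp only [conj_trivial]
    nlinarith

theorem outwardNormal_eq_of_unique {Ω : Set Plane} {y ν : Plane} (h : IsOutwardUnitNormal Ω y ν)
    (hu : ∀ ν', IsOutwardUnitNormal Ω y ν' → ν' = ν) : outwardNormal Ω y = ν := by
  have hex : ∃ ν, IsOutwardUnitNormal Ω y ν := ⟨ν, h⟩
  rw [outwardNormal, dif_pos hex]
  exact hu _ hex.choose_spec

theorem eventually_ray_mem_strip {h w d t : ℝ} (ht : |t| < w) (hd : 0 < d) (v : Plane) :
    ∀ᶠ s : ℝ in 𝓝[>] 0, |(horizontal h t + s • v) 0| < w ∧ |s * v 1| < d ∧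
      |(horizontal h t - s • v) 0| < w := by
  have c1 : Continuous fun s : ℝ => |(horizontal h t + s • v) 0| := by fun_prop
  have c2 : Continuous fun s : ℝ => |s * v 1| := by fun_prop
  have c3 : Continuous fun s : ℝ => |(horizontal h t - s • v) 0| := by fun_prop
  have e1 := (c1.tendsto 0).eventually_lt_const (u := w) (by simpa using ht)
  have e2 := (c2.tendsto 0).eventually_lt_const (u := d) (by simpa using hd)
  have e3 := (c3.tendsto 0).eventually_lt_const (u := w) (by simpa using ht)
  exact ((e1.and (e2.and e3)).filter_mono nhdsWithin_le_nhds)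

/-- The vector `horizontal σ 0` is `(0, σ)`. Since `outwardNormal` is a choice, uniqueness of the
normal has to be proved as well. -/
theorem outwardNormal_flat {Ω : Set Plane} {h w d t σ : ℝ} (hσ : σ = 1 ∨ σ = -1)
    (ht : |t| < w) (hd : 0 < d)
    (hout : ∀ x : Plane, |x 0| < w → 0 < σ * (x 1 - h) → σ * (x 1 - h) < d → x ∉ Ω)
    (hin : ∀ x : Plane, |x 0| < w → 0 < -σ * (x 1 - h) → -σ * (x 1 - h) < d → x ∈ Ω) :
    outwardNormal Ω (horizontal h t) = horizontal σ 0 := by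
  have hσ2 : σ ^ 2 = 1 := by rcases hσ with rfl | rfl <;> norm_num
  refine outwardNormal_eq_of_unique ⟨?_, fun ε hε => ?_⟩ fun ν hν => ?_
  · have := norm_sq_eq (horizontal σ 0)
    simp only [horizontal_zero, horizontal_one, hσ2] at this
    nlinarith [norm_nonneg (horizontal σ 0)]
  · have c1 : Continuous fun z : Plane => |z 0| := by fun_prop
    have c2 : Continuous fun z : Plane => |z 1 - h| := by fun_prop
    filter_upwards [(c1.tendsto (horizontal h t)).eventually_lt_const (u := w) (by simpa using ht),
      (c2.tendsto (horizontal h t)).eventually_lt_const (u := d) (by simpa using hd)]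
      with z hz0 hz1
    have hle : |σ * (z 1 - h)| < d := by
      rw [abs_mul]; rcases hσ with rfl | rfl <;> simpa using hz1
    have hin' : inner ℝ (z - horizontal h t) (horizontal σ 0) = σ * (z 1 - h) := by
      rw [inner_eq]; simp; ring
    rw [hin']
    have hn : 0 ≤ ε * ‖z - horizontal h t‖ := by positivity
    refine ⟨fun h1 => hout z hz0 (by linarith) (abs_lt.1 hle).2, fun h1 => hin z hz0 ?_ ?_⟩
    · linarith
    · linarith [(abs_lt.1 hle).1]
  · by_contra hne
    have hν1 : ν 0 ^ 2 + ν 1 ^ 2 = 1 := by rw [← norm_sq_eq, hν.1, one_pow]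
    have hlt : σ * ν 1 < 1 := by
      by_contra! hge
      have h1 : ν 1 = σ := by
        have : (ν 1 - σ) ^ 2 ≤ 0 := by nlinarith [sq_nonneg (ν 0)]
        nlinarith [sq_nonneg (ν 1 - σ), pow_eq_zero_iff (two_ne_zero) |>.1
          (le_antisymm this (sq_nonneg _))]
      have h0 : ν 0 = 0 := by
        have : ν 0 ^ 2 = 0 := by rw [h1] at hν1; linarith
        exact pow_eq_zero_iff (two_ne_zero) |>.1 this
      exact hne (by rw [eq_horizontal ν, h0, h1])
    -- The direction `ν - (0, σ)` is acute to `ν`, so it should leave `Ω`; yet its vertical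
    -- component points to the inner side.
    have hv : 0 < inner ℝ (ν - horizontal σ 0) ν := by
      rw [inner_eq]; simp; nlinarith
    obtain ⟨s, ⟨hs1, -⟩, ⟨hs2, hs3, -⟩, hs⟩ := ((hν.eventually_ray hv).and
      ((eventually_ray_mem_strip (h := h) ht hd (ν - horizontal σ 0)).and
        self_mem_nhdsWithin)).exists
    have hs : 0 < s := hs
    have e1 : (horizontal h t + s • (ν - horizontal σ 0)) 1 - h = s * (ν - horizontal σ 0) 1 := by
      simp
    refine hs1 (hin _ hs2 ?_ ?_)
    · rw [e1]; simp
      have : 0 < s * (1 - σ * ν 1) := mul_pos hs (by linarith)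
      nlinarith
    · rw [e1]
      refine lt_of_le_of_lt (le_abs_self _) ?_
      rw [abs_mul, abs_neg]
      rcases hσ with rfl | rfl <;> simpa using hs3

theorem outwardNormal_flat_eq_zero {Ω : Set Plane} {h w d t : ℝ} (ht : |t| < w) (hd : 0 < d)
    (hin : ∀ x : Plane, |x 0| < w → x 1 ≠ h → |x 1 - h| < d → x ∈ Ω) :
    outwardNormal Ω (horizontal h t) = 0 := by
  rw [outwardNormal, dif_neg]
  rintro ⟨ν, hν⟩
  have hν1 : ν 0 ^ 2 + ν 1 ^ 2 = 1 := by rw [← norm_sq_eq, hν.1, one_pow]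
  -- A non-horizontal direction acute to `ν` would leave `Ω`, but both sides of the line belong to
  -- `Ω`.
  obtain ⟨v, hv, hv1⟩ : ∃ v : Plane, 0 < inner ℝ v ν ∧ v 1 ≠ 0 := by
    by_cases h1 : ν 1 = 0
    · refine ⟨ν + horizontal 1 0, ?_, ?_⟩
      · rw [inner_eq]; simp; nlinarith
      · simp [h1]
    · exact ⟨ν, by rw [inner_eq]; nlinarith, h1⟩
  obtain ⟨s, ⟨hs1, -⟩, ⟨hs2, hs3, -⟩, hs⟩ := ((hν.eventually_ray hv).and
    ((eventually_ray_mem_strip (h := h) ht hd v).and self_mem_nhdsWithin)).exists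
  have hs : 0 < s := hs
  refine hs1 (hin _ hs2 ?_ ?_)
  · simp [hs.ne', hv1]
  · simpa using hs3

/-- Near a flat piece of its boundary, an open set lies on one side at least. -/
theorem exists_mem_near_flat {Ω : Set Plane} (hΩ : IsOpen Ω) {h w d t : ℝ} (ht : |t| < w)
    (hd : 0 < d) (hfr : horizontal h t ∈ frontier Ω) :
    ∃ x : Plane, |x 0| < w ∧ x 1 ≠ h ∧ |x 1 - h| < d ∧ x ∈ Ω := by
  have c1 : Continuous fun z : Plane => |z 0| := by fun_prop
  have c2 : Continuous fun z : Plane => |z 1 - h| := by fun_prop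
  obtain ⟨p, hpΩ, hp0, hp1⟩ :=
    ((mem_closure_iff_frequently.1 (frontier_subset_closure hfr)).and_eventually
      (((c1.tendsto (horizontal h t)).eventually_lt_const (u := w) (by simpa using ht)).and
      ((c2.tendsto (horizontal h t)).eventually_lt_const (u := d) (by simpa using hd)))).exists
  -- A point of `Ω` on the line itself is pushed slightly upwards, which openness of `Ω` allows.
  by_cases hph : p 1 = h
  · have c3 : Continuous fun s : ℝ => p + horizontal s 0 := by
      unfold horizontal; fun_prop
    have hp : p + horizontal 0 0 = p := by ext i; fin_cases i <;> simp
    have e1 := (c3.tendsto 0).eventually (hΩ.mem_nhds (by rw [hp]; exact hpΩ))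
    have e2 : ∀ᶠ s : ℝ in 𝓝[>] 0, s < d := nhdsWithin_le_nhds (Iio_mem_nhds hd)
    obtain ⟨s, hs1, hs2, hs3⟩ := ((e1.filter_mono (nhdsWithin_le_nhds (s := Set.Ioi 0))).and
      (e2.and self_mem_nhdsWithin)).exists
    have hs3 : 0 < s := hs3
    refine ⟨_, ?_, ?_, ?_, hs1⟩
    · simpa using hp0
    · simp [hph, hs3.ne']
    · simpa [hph, abs_of_pos hs3] using hs2
  · exact ⟨p, hp0, hph, hp1, hpΩ⟩

/-! ### Bounds for the `H^{1/2}` norm -/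

theorem ae_mem_frontier (Ω : Set Plane) : ∀ᵐ x ∂(arcLength Ω), x ∈ frontier Ω :=
  ae_restrict_mem isClosed_frontier.measurableSet

/-- Both integrands are at most `L²`, so the square of the norm is at most `L² m + L² m² ≤ (2Lm)²`.
The bound is crude, but its linear growth in `m` is affordable. -/
theorem hHalfNorm_le {Ω : Set Plane} {h : Plane → ℂ} {L m : ℝ} (hL : 0 ≤ L) (hm : 1 ≤ m)
    (hμ : Measure.hausdorffMeasure 1 (frontier Ω) ≤ ENNReal.ofReal m)
    (hbd : ∀ x ∈ frontier Ω, ‖h x‖ ≤ L)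
    (hlip : ∀ x ∈ frontier Ω, ∀ z ∈ frontier Ω, ‖h x - h z‖ ≤ L * dist x z) :
    hHalfNorm Ω h ≤ ENNReal.ofReal (2 * L * m) := by
  have hμ' : arcLength Ω Set.univ ≤ ENNReal.ofReal m := by
    rw [arcLength, Measure.restrict_apply_univ]; exact hμ
  have h1 : ∫⁻ x, ‖h x‖ₑ ^ 2 ∂(arcLength Ω) ≤ ENNReal.ofReal (L ^ 2 * m) := by
    calc ∫⁻ x, ‖h x‖ₑ ^ 2 ∂(arcLength Ω) ≤ ∫⁻ _, ENNReal.ofReal (L ^ 2) ∂(arcLength Ω) := by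
          refine lintegral_mono_ae ?_
          filter_upwards [ae_mem_frontier Ω] with x hx
          rw [← ofReal_norm, ENNReal.ofReal_pow hL]
          gcongr
          exact hbd x hx
      _ ≤ ENNReal.ofReal (L ^ 2 * m) := by
          rw [lintegral_const, ENNReal.ofReal_mul (by positivity)]
          gcongr
  have hin : ∀ x ∈ frontier Ω, ∫⁻ z, ‖h x - h z‖ₑ ^ 2 / edist x z ^ 2 ∂(arcLength Ω) ≤
      ENNReal.ofReal (L ^ 2 * m) := fun x hx => by
    calc ∫⁻ z, ‖h x - h z‖ₑ ^ 2 / edist x z ^ 2 ∂(arcLength Ω)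
        ≤ ∫⁻ _, ENNReal.ofReal (L ^ 2) ∂(arcLength Ω) := by
          refine lintegral_mono_ae ?_
          filter_upwards [ae_mem_frontier Ω] with z hz
          refine ENNReal.div_le_of_le_mul ?_
          rw [ENNReal.ofReal_pow hL, ← mul_pow, ← ofReal_norm, edist_dist,
            ← ENNReal.ofReal_mul hL]
          exact pow_le_pow_left' (ENNReal.ofReal_le_ofReal (hlip x hx z hz)) 2
      _ ≤ ENNReal.ofReal (L ^ 2 * m) := by
          rw [lintegral_const, ENNReal.ofReal_mul (by positivity)]
          gcongr
  have h2 : ∫⁻ x, ∫⁻ z, ‖h x - h z‖ₑ ^ 2 / edist x z ^ 2 ∂(arcLength Ω) ∂(arcLength Ω) ≤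
      ENNReal.ofReal (L ^ 2 * m * m) := by
    calc _ ≤ ∫⁻ _, ENNReal.ofReal (L ^ 2 * m) ∂(arcLength Ω) := by
          refine lintegral_mono_ae ?_
          filter_upwards [ae_mem_frontier Ω] with x hx using hin x hx
      _ ≤ ENNReal.ofReal (L ^ 2 * m * m) := by
          rw [lintegral_const, ENNReal.ofReal_mul (p := L ^ 2 * m) (by positivity)]
          gcongr
  rw [hHalfNorm]
  calc _ ≤ (ENNReal.ofReal ((2 * L * m) ^ 2)) ^ (1 / 2 : ℝ) := by
        gcongr
        refine (add_le_add h1 h2).trans ?_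
        rw [← ENNReal.ofReal_add (by positivity) (by positivity)]
        refine ENNReal.ofReal_le_ofReal ?_
        have h3 : L ^ 2 * m ≤ L ^ 2 * m * m := le_mul_of_one_le_right (by positivity) hm
        have h4 : 0 ≤ L ^ 2 * m * m := by positivity
        nlinarith
    _ = ENNReal.ofReal (2 * L * m) := by
        rw [ENNReal.ofReal_rpow_of_nonneg (by positivity) (by positivity), ← Real.sqrt_eq_rpow,
          Real.sqrt_sq (by positivity)]

theorem memHHalf_of_lipschitz {Ω : Set Plane} {h : Plane → ℂ} {L : ℝ}
    (hΩ : IsBoundedLipschitzDomain Ω) (hbd : ∀ x ∈ frontier Ω, ‖h x‖ ≤ L)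
    (hlip : ∀ x ∈ frontier Ω, ∀ z ∈ frontier Ω, ‖h x - h z‖ ≤ L * dist x z) :
    MemHHalf Ω h := by
  have hlip' : ∀ x ∈ frontier Ω, ∀ z ∈ frontier Ω, ‖h x - h z‖ ≤ max L 0 * dist x z :=
    fun x hx z hz => (hlip x hx z hz).trans (by gcongr; exact le_max_left _ _)
  constructor
  · have : LipschitzOnWith (max L 0).toNNReal h (frontier Ω) :=
      LipschitzOnWith.of_dist_le_mul fun x hx z hz => by
        rw [Real.coe_toNNReal _ (le_max_right _ _), dist_eq_norm]
        exact hlip' x hx z hz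
    exact this.continuousOn.aestronglyMeasurable isClosed_frontier.measurableSet
  · refine (hHalfNorm_le (m := max 1 (Measure.hausdorffMeasure 1 (frontier Ω)).toReal)
      (le_max_right L 0) (le_max_left _ _) ?_
      (fun x hx => (hbd x hx).trans (le_max_left _ _)) hlip').trans_lt ENNReal.ofReal_lt_top
    rw [← ENNReal.ofReal_toReal hΩ.hausdorffMeasure_frontier_lt_top.ne]
    exact ENNReal.ofReal_le_ofReal (by rw [ENNReal.toReal_ofReal] <;> simp)

/-- The `L²` part alone over the central segment of length `w` suffices, with integrand at least
`1/4`. -/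
theorem le_hHalfNorm {Ω : Set Plane} {φ : Plane → ℂ} {h w : ℝ}
    (hfr : ∀ t, |t| ≤ w / 2 → horizontal h t ∈ frontier Ω)
    (hφ : ∀ t, |t| ≤ w / 2 → 1 / 2 ≤ ‖φ (horizontal h t)‖) :
    ENNReal.ofReal (w / 4) ^ (1 / 2 : ℝ) ≤ hHalfNorm Ω φ := by
  rw [hHalfNorm]
  gcongr
  refine le_trans ?_ le_self_add
  set S := horizontal h '' Set.Icc (-(w / 2)) (w / 2) with hS
  have hSfr : S ⊆ frontier Ω := by
    rintro _ ⟨t, ht, rfl⟩; exact hfr t (abs_le.2 ht)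
  have hSm : MeasurableSet S :=
    (measurableEmbedding_horizontal h).measurableSet_image.2 measurableSet_Icc
  calc ENNReal.ofReal (w / 4)
      = ∫⁻ _ in S, ENNReal.ofReal (1 / 4) ∂(Measure.hausdorffMeasure 1) := by
        rw [lintegral_const, Measure.restrict_apply_univ, hS, hausdorffMeasure_horizontal_image,
          Real.volume_Icc, ← ENNReal.ofReal_mul (by norm_num)]
        congr 1; ring
    _ ≤ ∫⁻ x in S, ‖φ x‖ₑ ^ 2 ∂(Measure.hausdorffMeasure 1) := by
        refine setLIntegral_mono' hSm ?_
        rintro _ ⟨t, ht, rfl⟩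
        rw [← ofReal_norm, ← ENNReal.ofReal_pow (norm_nonneg _)]
        have := hφ t (abs_le.2 ht)
        exact ENNReal.ofReal_le_ofReal (by nlinarith)
    _ ≤ ∫⁻ x, ‖φ x‖ₑ ^ 2 ∂(arcLength Ω) :=
        lintegral_mono' (Measure.restrict_mono hSfr le_rfl) le_rfl

/-! ### Absolutely convergent Neumann–Poincaré integrals -/

/-- The integral `∫ k(x,y) φ(y) ds(y)` converges absolutely, with value `l`. -/
def HasNPIntegral (Ω : Set Plane) (φ : Plane → ℂ) (x : Plane) (l : ℂ) : Prop :=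
  Integrable (fun y => (npKernel Ω x y : ℂ) * φ y) (arcLength Ω) ∧
    ∫ y, (npKernel Ω x y : ℂ) * φ y ∂(arcLength Ω) = l

theorem tendsto_integral_truncation {X E : Type*} [PseudoMetricSpace X] [MeasurableSpace X]
    [OpensMeasurableSpace X] [NormedAddCommGroup E] [NormedSpace ℝ E] {μ : Measure X} {F : X → E}
    (hF : Integrable F μ) {x : X} (hx : ∀ y, dist x y = 0 → F y = 0) :
    Tendsto (fun ε : ℝ => ∫ y in {y | ε ≤ dist x y}, F y ∂μ) (𝓝[>] 0) (𝓝 (∫ y, F y ∂μ)) := by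
  have hm : ∀ ε : ℝ, MeasurableSet {y | ε ≤ dist x y} := fun ε =>
    (isClosed_le continuous_const (by fun_prop)).measurableSet
  simp_rw [fun ε => (integral_indicator (μ := μ) (f := F) (hm ε)).symm]
  refine tendsto_integral_filter_of_dominated_convergence (fun y => ‖F y‖)
    (Eventually.of_forall fun ε => hF.aestronglyMeasurable.indicator (hm ε))
    (Eventually.of_forall fun ε => Eventually.of_forall fun y => norm_indicator_le_norm_self _ _)
    hF.norm (Eventually.of_forall fun y => ?_)
  rcases (dist_nonneg (x := x) (y := y)).eq_or_lt with h0 | h0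
  · have : ∀ ε : ℝ, {y | ε ≤ dist x y}.indicator F y = F y := fun ε => by
      rw [Set.indicator_apply, hx y h0.symm]; simp
    simp [this]
  · refine tendsto_const_nhds.congr' ?_
    filter_upwards [nhdsWithin_le_nhds (Iio_mem_nhds h0)] with ε hε
    rw [Set.indicator_of_mem]
    exact (Set.mem_Iio.1 hε).le

theorem HasNPIntegral.tendsto {Ω : Set Plane} {φ : Plane → ℂ} {x : Plane} {l : ℂ}
    (h : HasNPIntegral Ω φ x l) : Tendsto (npTrunc Ω φ x) (𝓝[>] 0) (𝓝 l) := by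
  rw [← h.2]
  refine tendsto_integral_truncation h.1 fun y hy => ?_
  rw [dist_eq_norm] at hy
  -- At `y = x` the kernel is a quotient by zero, hence `0`, so the truncations lose nothing at the
  -- excluded point.
  simp [npKernel, hy]

theorem HasNPIntegral.npExists {Ω : Set Plane} {φ : Plane → ℂ} {x : Plane} {l : ℂ}
    (h : HasNPIntegral Ω φ x l) : NPExists Ω φ x :=
  ⟨fun _ _ => h.1.integrableOn, l, h.tendsto⟩

theorem HasNPIntegral.npOperator_eq {Ω : Set Plane} {φ : Plane → ℂ} {x : Plane} {l : ℂ}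
    (h : HasNPIntegral Ω φ x l) : npOperator Ω φ x = l :=
  h.tendsto.limUnder_eq

theorem HasNPIntegral.add {Ω : Set Plane} {φ ψ : Plane → ℂ} {x : Plane} {l m : ℂ}
    (h : HasNPIntegral Ω φ x l) (h' : HasNPIntegral Ω ψ x m) :
    HasNPIntegral Ω (fun y => φ y + ψ y) x (l + m) := by
  simp only [HasNPIntegral, mul_add]
  exact ⟨h.1.add h'.1, by rw [integral_add h.1 h'.1, h.2, h'.2]⟩

/-! ### Densities supported on a flat piece of the boundary -/

/-- The density on the line at height `h` with profile `f`. -/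
noncomputable def layer (h : ℝ) (f : ℝ → ℂ) (x : Plane) : ℂ :=
  open Classical in if x 1 = h then f (x 0) else 0

theorem layer_of_eq {h : ℝ} {f : ℝ → ℂ} {x : Plane} (hx : x 1 = h) : layer h f x = f (x 0) :=
  if_pos hx

theorem layer_of_ne {h : ℝ} {f : ℝ → ℂ} {x : Plane} (hx : x 1 ≠ h) : layer h f x = 0 :=
  if_neg hx

/-- The kernel `v₂ / |v|²`, `v = (t, h) - x`. -/
noncomputable def flatKernel (h : ℝ) (x : Plane) (t : ℝ) : ℝ :=
  (h - x 1) / ((t - x 0) ^ 2 + (h - x 1) ^ 2)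

/-- The double layer potential, up to the factor `1 / 2π`, of the density `layer h f`. -/
noncomputable def potential (h : ℝ) (f : ℝ → ℂ) (x : Plane) : ℂ :=
  ∫ t, (flatKernel h x t : ℂ) * f t

theorem flatKernel_of_eq {h : ℝ} {x : Plane} (hx : x 1 = h) (t : ℝ) : flatKernel h x t = 0 := by
  simp [flatKernel, hx]

theorem potential_of_eq {h : ℝ} {f : ℝ → ℂ} {x : Plane} (hx : x 1 = h) : potential h f x = 0 := by
  simp [potential, flatKernel_of_eq hx]

theorem flatKernel_eq_div_dist (h : ℝ) (x : Plane) (t : ℝ) :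
    flatKernel h x t = (h - x 1) / dist x (horizontal h t) ^ 2 := by
  rw [dist_sq_eq, flatKernel]; simp; ring

theorem continuous_flatKernel {h : ℝ} {x : Plane} : Continuous (flatKernel h x) := by
  by_cases hx : x 1 = h
  · simp_rw [funext (flatKernel_of_eq hx)]; exact continuous_const
  · have : 0 < (h - x 1) ^ 2 := by
      have := sub_ne_zero.2 (Ne.symm hx); positivity
    unfold flatKernel
    refine continuous_const.div (by fun_prop) fun t => by positivity

theorem integrable_flatKernel_mul {h w : ℝ} {f : ℝ → ℂ} (hf : Continuous f)
    (hsupp : ∀ t, w ≤ |t| → f t = 0) (x : Plane) :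
    Integrable fun t => (flatKernel h x t : ℂ) * f t := by
  refine Continuous.integrable_of_hasCompactSupport
    ((Complex.continuous_ofReal.comp continuous_flatKernel).mul hf) ?_
  refine HasCompactSupport.intro (isCompact_Icc (a := -w) (b := w)) fun t ht => ?_
  rw [hsupp t, mul_zero]
  by_contra! hlt
  exact ht ⟨(abs_lt.1 hlt).1.le, (abs_lt.1 hlt).2.le⟩

theorem norm_integral_le_of_support {w B : ℝ} (hw : 0 ≤ w) {F : ℝ → ℂ}
    (hsupp : ∀ t, w ≤ |t| → F t = 0) (hB : ∀ t, |t| < w → ‖F t‖ ≤ B) :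
    ‖∫ t, F t‖ ≤ 2 * w * B := by
  have h1 : ∫ t, F t = ∫ t in Set.Ioo (-w) w, F t := by
    refine (setIntegral_eq_integral_of_forall_compl_eq_zero fun t ht => hsupp t ?_).symm
    by_contra! hlt
    exact ht (abs_lt.1 hlt)
  rw [h1]
  refine (norm_setIntegral_le_of_norm_le_const (s := Set.Ioo (-w) w) (C := B)
    (by rw [Real.volume_Ioo]; exact ENNReal.ofReal_lt_top) fun t ht => hB t (abs_lt.2 ht)).trans ?_
  rw [measureReal_def, Real.volume_Ioo, ENNReal.toReal_ofReal (by linarith)]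
  linarith

theorem norm_potential_le {h w B : ℝ} (hw : 0 ≤ w) {f : ℝ → ℂ} (hf1 : ∀ t, ‖f t‖ ≤ 1)
    (hsupp : ∀ t, w ≤ |t| → f t = 0) {x : Plane}
    (hB : ∀ t, |t| < w → |flatKernel h x t| ≤ B) : ‖potential h f x‖ ≤ 2 * w * B := by
  refine norm_integral_le_of_support hw (fun t ht => by rw [hsupp t ht, mul_zero]) fun t ht => ?_
  rw [norm_mul, Complex.norm_real, Real.norm_eq_abs]
  exact (mul_le_of_le_one_right (abs_nonneg _) (hf1 t)).trans (hB t ht)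

theorem norm_potential_sub_le {h w B : ℝ} (hw : 0 ≤ w) {f : ℝ → ℂ} (hf : Continuous f)
    (hf1 : ∀ t, ‖f t‖ ≤ 1) (hsupp : ∀ t, w ≤ |t| → f t = 0) {x z : Plane}
    (hB : ∀ t, |t| < w → |flatKernel h x t - flatKernel h z t| ≤ B) :
    ‖potential h f x - potential h f z‖ ≤ 2 * w * B := by
  rw [potential, potential, ← integral_sub (integrable_flatKernel_mul hf hsupp x)
    (integrable_flatKernel_mul hf hsupp z)]
  simp_rw [← sub_mul, ← Complex.ofReal_sub]
  refine norm_integral_le_of_support hw (fun t ht => by rw [hsupp t ht, mul_zero]) fun t ht => ?_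
  rw [norm_mul, Complex.norm_real, Real.norm_eq_abs]
  exact (mul_le_of_le_one_right (abs_nonneg _) (hf1 t)).trans (hB t ht)

theorem abs_flatKernel_le {h ρ : ℝ} (hρ : 0 < ρ) {x : Plane} {t : ℝ}
    (hd : ρ ≤ dist x (horizontal h t)) : |flatKernel h x t| ≤ |h - x 1| / ρ ^ 2 := by
  rw [flatKernel_eq_div_dist, abs_div, abs_of_nonneg (sq_nonneg (dist _ _))]
  gcongr

/-- The kernel is the second coordinate of the inversion `v ↦ v / |v|²` at `v = (t, h) - x`, and
inversion satisfies `|u* - v*| = |u - v| / (|u| |v|)`. -/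
theorem abs_flatKernel_sub_le {h ρ : ℝ} (hρ : 0 < ρ) {x z : Plane} {t : ℝ}
    (hx : ρ ≤ dist x (horizontal h t)) (hz : ρ ≤ dist z (horizontal h t)) :
    |flatKernel h x t - flatKernel h z t| ≤ dist x z / ρ ^ 2 := by
  have hx0 : horizontal h t - x ≠ 0 := fun h0 => by
    rw [dist_comm, dist_eq_norm, h0, norm_zero] at hx; linarith
  have hz0 : horizontal h t - z ≠ 0 := fun h0 => by
    rw [dist_comm, dist_eq_norm, h0, norm_zero] at hz; linarith
  have e : ∀ y : Plane, flatKernel h y t =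
      ((1 / ‖horizontal h t - y‖) ^ 2 • (horizontal h t - y)) 1 := fun y => by
    rw [flatKernel_eq_div_dist, dist_comm, dist_eq_norm]
    simp; ring
  rw [e x, e z]
  refine (abs_coord_sub_le_dist _ _ 1).trans ?_
  rw [dist_div_norm_sq_smul hx0 hz0 1, dist_sub_left, ← dist_eq_norm, ← dist_eq_norm,
    dist_comm _ x, dist_comm _ z, one_pow, div_mul_eq_mul_div, one_mul, sq]
  gcongr

/-- On `x₂ = h` the kernel vanishes, so no condition on the distance is needed there. -/
theorem abs_flatKernel_sub_le_of_line {h ρ : ℝ} (hρ : 0 < ρ) {x z : Plane} {t : ℝ}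
    (hx : x 1 = h ∨ ρ ≤ dist x (horizontal h t)) (hz : z 1 = h ∨ ρ ≤ dist z (horizontal h t)) :
    |flatKernel h x t - flatKernel h z t| ≤ dist x z / ρ ^ 2 := by
  have key : ∀ x z : Plane, x 1 = h → ρ ≤ dist z (horizontal h t) →
      |flatKernel h z t| ≤ dist x z / ρ ^ 2 := fun x z hx hz => by
    refine (abs_flatKernel_le hρ hz).trans ?_
    gcongr
    rw [← hx]; exact abs_coord_sub_le_dist x z 1
  rcases hx with hx | hx <;> rcases hz with hz | hz
  · rw [flatKernel_of_eq hx, flatKernel_of_eq hz]; simp; positivity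
  · rw [flatKernel_of_eq hx, zero_sub, abs_neg]; exact key x z hx hz
  · rw [flatKernel_of_eq hz, sub_zero, dist_comm]; exact key z x hz hx
  · exact abs_flatKernel_sub_le hρ hx hz

/-- No genuine principal value occurs: for `x` on the line the kernel vanishes identically, and off
the line it is continuous against a compactly supported profile. The normal enters only through its
constant vertical component `c`, which is allowed to be `0`. -/
theorem hasNPIntegral_layer {Ω : Set Plane} {h w c : ℝ} {f : ℝ → ℂ} (hf : Continuous f)
    (hsupp : ∀ t, w ≤ |t| → f t = 0)
    (hfr : ∀ t, |t| < w → horizontal h t ∈ frontier Ω)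
    (hn : ∀ t, |t| < w → outwardNormal Ω (horizontal h t) = horizontal c 0) (x : Plane) :
    HasNPIntegral Ω (layer h f) x ((c / (2 * Real.pi) : ℝ) * potential h f x) := by
  set F : Plane → ℂ := fun y => (npKernel Ω x y : ℂ) * layer h f y with hF
  set S := horizontal h '' Set.Ioo (-w) w with hS
  have hSfr : S ⊆ frontier Ω := by
    rintro _ ⟨t, ht, rfl⟩; exact hfr t (abs_lt.2 ht)
  have hF0 : ∀ y, y ∉ S → F y = 0 := fun y hy => by
    by_cases hyh : y 1 = h
    · have : w ≤ |y 0| := by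
        by_contra! hlt
        exact hy ⟨y 0, abs_lt.1 hlt, by rw [← hyh, ← eq_horizontal]⟩
      simp only [hF, layer_of_eq hyh, hsupp _ this, mul_zero]
    · simp only [hF, layer_of_ne hyh, mul_zero]
  have hrestr : (arcLength Ω).restrict S =
      Measure.map (horizontal h) (volume.restrict (Set.Ioo (-w) w)) := by
    rw [arcLength, Measure.restrict_restrict_of_subset hSfr, restrict_horizontal_image]
  set G : ℝ → ℂ := fun t => (c / (2 * Real.pi) : ℝ) * ((flatKernel h x t : ℂ) * f t) with hG
  have hFG : Set.EqOn (F ∘ horizontal h) G (Set.Ioo (-w) w) := fun t ht => by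
    simp only [Function.comp, hF, hG, layer_of_eq (horizontal_one h t), horizontal_zero, npKernel,
      hn t (abs_lt.2 ht), flatKernel_eq_div_dist, dist_eq_norm, inner_eq]
    push_cast
    simp
    ring
  have hGi : Integrable G := (integrable_flatKernel_mul hf hsupp x).const_mul _
  have hG0 : ∀ t, t ∉ Set.Ioo (-w) w → G t = 0 := fun t ht => by
    have : w ≤ |t| := by
      by_contra! hlt
      exact ht (abs_lt.1 hlt)
    simp [hG, hsupp t this]
  constructor
  · rw [← integrableOn_iff_integrable_of_support_subset
      (s := S) fun y hy => by_contra fun h' => hy (hF0 y h'), IntegrableOn, hrestr,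
      (measurableEmbedding_horizontal h).integrable_map_iff]
    exact (integrableOn_congr_fun hFG measurableSet_Ioo).2 hGi.integrableOn
  · rw [← setIntegral_eq_integral_of_forall_compl_eq_zero (s := S) hF0, hrestr,
      (measurableEmbedding_horizontal h).integral_map,
      setIntegral_congr_fun (f := fun t => F (horizontal h t)) (g := G) measurableSet_Ioo hFG,
      setIntegral_eq_integral_of_forall_compl_eq_zero hG0, hG, integral_const_mul, potential]

/-! ### The kernel of the strip -/

/-- The kernel by which a density on one line acts on a parallel line at distance `2`. -/
noncomputable def stripKernel (s : ℝ) : ℝ := 1 / (Real.pi * (4 + s ^ 2))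

theorem stripKernel_nonneg (s : ℝ) : 0 ≤ stripKernel s := by
  unfold stripKernel; positivity

theorem stripKernel_eq (s : ℝ) :
    stripKernel s = 1 / (4 * Real.pi) * (1 + (s / 2) ^ 2)⁻¹ := by
  unfold stripKernel; field_simp; ring

theorem continuous_stripKernel : Continuous stripKernel := by
  unfold stripKernel
  exact continuous_const.div (by fun_prop) fun s => by positivity

theorem integrable_stripKernel : Integrable stripKernel := by
  rw [funext stripKernel_eq]
  exact (integrable_inv_one_add_sq.comp_div (two_ne_zero)).const_mul _

theorem integral_stripKernel : ∫ s, stripKernel s = 1 / 2 := by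
  rw [funext stripKernel_eq, integral_const_mul,
    Measure.integral_comp_div (fun s : ℝ => (1 + s ^ 2)⁻¹) 2, integral_univ_inv_one_add_sq]
  simp; field_simp; norm_num

/-- The kernel decays like `s⁻²`, so its first absolute moment diverges and an exponent below `1` is
needed. It must also exceed `1/2` for the final power of `w` to be negative; `3/4` is one such
choice. -/
theorem integrable_stripKernel_mul_rpow :
    Integrable fun s => stripKernel s * |s| ^ (3 / 4 : ℝ) := by
  have h1 : Integrable fun s : ℝ => (1 + ‖s‖) ^ (-(5 / 4) : ℝ) :=
    integrable_one_add_norm (by simp; norm_num)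
  refine (h1.const_mul 2).mono' (continuous_stripKernel.mul
    (continuous_abs.rpow_const fun _ => Or.inr (by norm_num))).aestronglyMeasurable
    (Eventually.of_forall fun s => ?_)
  have hs : 0 ≤ |s| := abs_nonneg s
  rw [Real.norm_of_nonneg (mul_nonneg (stripKernel_nonneg s) (by positivity)), Real.norm_eq_abs]
  have h2 : |s| ^ (3 / 4 : ℝ) ≤ (1 + |s|) ^ (3 / 4 : ℝ) :=
    Real.rpow_le_rpow hs (by linarith) (by norm_num)
  have h3 : stripKernel s ≤ 2 * (1 + |s|) ^ (-2 : ℝ) := by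
    rw [Real.rpow_neg (by positivity), Real.rpow_two, stripKernel, ← div_eq_mul_inv,
      div_le_div_iff₀ (by positivity) (by positivity), ← sq_abs s]
    have : (1 : ℝ) ≤ Real.pi := by linarith [Real.pi_gt_three]
    nlinarith [sq_nonneg (|s| - 1)]
  calc stripKernel s * |s| ^ (3 / 4 : ℝ)
      ≤ (2 * (1 + |s|) ^ (-2 : ℝ)) * (1 + |s|) ^ (3 / 4 : ℝ) := by gcongr
    _ = 2 * (1 + |s|) ^ (-(5 / 4) : ℝ) := by
        rw [mul_assoc, ← Real.rpow_add (by positivity)]; norm_num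

/-- The plane wave `e^{iξt}`. -/
noncomputable def wave (ξ t : ℝ) : ℂ := Complex.exp ((ξ * t : ℝ) * Complex.I)

theorem norm_wave (ξ t : ℝ) : ‖wave ξ t‖ = 1 := Complex.norm_exp_ofReal_mul_I _

theorem wave_add (ξ s t : ℝ) : wave ξ (s + t) = wave ξ s * wave ξ t := by
  rw [wave, wave, wave, ← Complex.exp_add]; congr 1; push_cast; ring

theorem continuous_wave (ξ : ℝ) : Continuous (wave ξ) := by unfold wave; fun_prop

theorem norm_wave_sub_le (ξ s t : ℝ) : ‖wave ξ s - wave ξ t‖ ≤ |ξ| * |s - t| := by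
  have h1 : wave ξ s - wave ξ t = wave ξ t * (Complex.exp (Complex.I * (ξ * (s - t) : ℝ)) - 1) := by
    have : wave ξ s = wave ξ t * Complex.exp (Complex.I * (ξ * (s - t) : ℝ)) := by
      rw [wave, wave, ← Complex.exp_add]; congr 1; push_cast; ring
    rw [this]; ring
  rw [h1, norm_mul, norm_wave, one_mul, ← abs_mul]
  exact Real.norm_exp_I_mul_ofReal_sub_one_le

theorem integrable_stripKernel_mul {F : ℝ → ℂ} {C : ℝ} (hF : Continuous F)
    (hC : ∀ s, ‖F s‖ ≤ C) : Integrable fun s => (stripKernel s : ℂ) * F s :=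
  integrable_stripKernel.ofReal.mul_bdd hF.aestronglyMeasurable (Eventually.of_forall hC)

/-- The kernel is real and even, so its Fourier integral equals its own conjugate. Being
real-valued, the symbol is accessible to the intermediate value theorem. -/
theorem integral_stripKernel_mul_wave_eq (ξ : ℝ) :
    ∫ s, (stripKernel s : ℂ) * wave ξ s = ((∫ s, stripKernel s * Real.cos (ξ * s) : ℝ) : ℂ) := by
  set I := ∫ s, (stripKernel s : ℂ) * wave ξ s with hI
  have hint := integrable_stripKernel_mul (continuous_wave ξ) fun s => (norm_wave ξ s).le
  have hconj : (starRingEnd ℂ) I = I := by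
    rw [hI, ← integral_conj, ← integral_neg_eq_self]
    congr 1; ext s
    rw [map_mul, Complex.conj_ofReal, wave, wave, ← Complex.exp_conj, stripKernel, stripKernel,
      neg_sq]
    congr 2
    simp
  rw [← Complex.conj_eq_iff_re.1 hconj]
  congr 1
  have : I.re = ∫ s, ((stripKernel s : ℂ) * wave ξ s).re :=
    (integral_re hint).symm
  rw [this]
  congr 1; ext s
  rw [Complex.re_ofReal_mul, wave, Complex.exp_ofReal_mul_I_re]

/-- Every number in `(0, 1/2]` is a value of the symbol of the strip. -/
theorem exists_integral_stripKernel_mul_wave_eq {lam : ℝ} (hlam : lam ∈ Set.Ioc (0 : ℝ) (1 / 2)) :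
    ∃ ξ : ℝ, ∫ s, (stripKernel s : ℂ) * wave ξ s = lam := by
  set J : ℝ → ℝ := fun ξ => ∫ s, stripKernel s * Real.cos (ξ * s) with hJ
  have hJc : Continuous J := by
    refine continuous_of_dominated (bound := stripKernel) (fun ξ => ?_) (fun ξ => ?_)
      integrable_stripKernel (Eventually.of_forall fun s => by fun_prop)
    · exact (continuous_stripKernel.mul (by fun_prop)).aestronglyMeasurable
    · refine Eventually.of_forall fun s => ?_
      rw [norm_mul, Real.norm_of_nonneg (stripKernel_nonneg s)]
      exact mul_le_of_le_one_right (stripKernel_nonneg s) (Real.abs_cos_le_one _)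
  have hJ0 : J 0 = 1 / 2 := by simp [hJ, integral_stripKernel]
  -- Riemann–Lebesgue; the factor `-2π` converts to the normalisation of `Real.fourierChar`.
  have hlim : Tendsto (fun w : ℝ => J (-(2 * Real.pi * w))) (cocompact ℝ) (𝓝 0) := by
    have h1 := Real.tendsto_integral_exp_smul_cocompact fun s => (stripKernel s : ℂ)
    have h2 : Tendsto (fun w : ℝ => ((J (-(2 * Real.pi * w)) : ℝ) : ℂ)) (cocompact ℝ) (𝓝 0) := by
      refine h1.congr fun w => ?_
      rw [hJ, ← integral_stripKernel_mul_wave_eq]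
      congr 1; ext s
      rw [Circle.smul_def, Real.fourierChar_apply, smul_eq_mul, mul_comm, wave]
      congr 2
      push_cast; ring
    have h3 := (Complex.continuous_re.tendsto 0).comp h2
    simpa [Function.comp_def] using h3
  have hev : ∀ᶠ w : ℝ in atTop, J (-(2 * Real.pi * w)) < lam :=
    (hlim.mono_left atTop_le_cocompact).eventually_lt_const hlam.1
  obtain ⟨w, hw⟩ := hev.exists
  obtain ⟨ξ, hξ⟩ := mem_range_of_exists_le_of_exists_ge hJc ⟨_, hw.le⟩ ⟨0, by rw [hJ0]; exact hlam.2⟩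
  exact ⟨ξ, by rw [integral_stripKernel_mul_wave_eq]; exact_mod_cast hξ⟩

/-! ### Wave packets -/

/-- The tent function of half-width `w`. -/
noncomputable def tent (w t : ℝ) : ℝ := max 0 (1 - |t| / w)

theorem tent_nonneg (w t : ℝ) : 0 ≤ tent w t := le_max_left _ _

theorem tent_le_one {w : ℝ} (hw : 0 < w) (t : ℝ) : tent w t ≤ 1 :=
  max_le zero_le_one (by have : 0 ≤ |t| / w := by positivity
                         linarith)

theorem tent_eq_zero {w t : ℝ} (hw : 0 < w) (ht : w ≤ |t|) : tent w t = 0 :=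
  max_eq_left (by rw [sub_nonpos, le_div_iff₀ hw]; linarith)

theorem half_le_tent {w t : ℝ} (hw : 0 < w) (ht : |t| ≤ w / 2) : 1 / 2 ≤ tent w t :=
  le_max_of_le_right (by
    have : |t| / w ≤ 1 / 2 := by rw [div_le_iff₀ hw]; linarith
    linarith)

theorem abs_tent_sub_le {w : ℝ} (hw : 0 < w) (s t : ℝ) : |tent w s - tent w t| ≤ |s - t| / w := by
  refine (abs_max_sub_max_le_max 0 _ 0 _).trans ?_
  rw [sub_self, abs_zero, max_eq_right (abs_nonneg _),
    show 1 - |s| / w - (1 - |t| / w) = -((|s| - |t|) / w) by ring, abs_neg, abs_div, abs_of_pos hw]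
  exact div_le_div_of_nonneg_right (abs_abs_sub_abs_le_abs_sub s t) hw.le

theorem abs_tent_sub_le_one {w : ℝ} (hw : 0 < w) (s t : ℝ) : |tent w s - tent w t| ≤ 1 := by
  rw [abs_le]
  constructor <;> linarith [tent_nonneg w s, tent_nonneg w t, tent_le_one hw s, tent_le_one hw t]

/-- Interpolation between the trivial bound `1` and the Lipschitz bound `|s - t| / w`, matched to
the available moment of the kernel. -/
theorem abs_tent_sub_le_rpow {w : ℝ} (hw : 0 < w) (s t : ℝ) :
    |tent w s - tent w t| ≤ w ^ (-(3 / 4) : ℝ) * |s - t| ^ (3 / 4 : ℝ) := by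
  have h1 := abs_tent_sub_le_one hw s t
  calc |tent w s - tent w t| = |tent w s - tent w t| ^ (1 : ℝ) := (Real.rpow_one _).symm
    _ ≤ |tent w s - tent w t| ^ (3 / 4 : ℝ) :=
        Real.rpow_le_rpow_of_exponent_ge' (abs_nonneg _) h1 (by norm_num) (by norm_num)
    _ ≤ (|s - t| / w) ^ (3 / 4 : ℝ) :=
        Real.rpow_le_rpow (abs_nonneg _) (abs_tent_sub_le hw s t) (by norm_num)
    _ = w ^ (-(3 / 4) : ℝ) * |s - t| ^ (3 / 4 : ℝ) := by
        rw [Real.div_rpow (abs_nonneg _) hw.le, Real.rpow_neg hw.le]; ring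

theorem continuous_tent (w : ℝ) : Continuous (tent w) := by unfold tent; fun_prop

/-- The plane wave `e^{iξt}` cut off by a tent function of half-width `w`. -/
noncomputable def packet (ξ w t : ℝ) : ℂ := wave ξ t * tent w t

theorem continuous_packet (ξ w : ℝ) : Continuous (packet ξ w) :=
  (continuous_wave ξ).mul (Complex.continuous_ofReal.comp (continuous_tent w))

theorem norm_packet (ξ w t : ℝ) : ‖packet ξ w t‖ = tent w t := by
  rw [packet, norm_mul, norm_wave, one_mul, Complex.norm_real,
    Real.norm_of_nonneg (tent_nonneg w t)]

theorem packet_eq_zero {ξ w t : ℝ} (hw : 0 < w) (ht : w ≤ |t|) : packet ξ w t = 0 := by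
  rw [packet, tent_eq_zero hw ht]; simp

theorem norm_packet_le_one {ξ w : ℝ} (hw : 0 < w) (t : ℝ) : ‖packet ξ w t‖ ≤ 1 := by
  rw [norm_packet]; exact tent_le_one hw t

theorem norm_packet_sub_le {ξ w : ℝ} (hw : 0 < w) (s t : ℝ) :
    ‖packet ξ w s - packet ξ w t‖ ≤ (|ξ| + 1 / w) * |s - t| := by
  have h1 : packet ξ w s - packet ξ w t =
      (wave ξ s - wave ξ t) * tent w s + wave ξ t * ((tent w s - tent w t : ℝ) : ℂ) := by
    simp only [packet]; push_cast; ring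
  rw [h1]
  refine (norm_add_le _ _).trans ?_
  rw [norm_mul, norm_mul, norm_wave, one_mul, Complex.norm_real, Complex.norm_real,
    Real.norm_of_nonneg (tent_nonneg w s), Real.norm_eq_abs, add_mul]
  refine add_le_add ?_ ((abs_tent_sub_le hw s t).trans_eq (by ring))
  exact (mul_le_of_le_one_right (norm_nonneg _) (tent_le_one hw s)).trans (norm_wave_sub_le ξ s t)

/-- The `3/4`-moment of the strip kernel. -/
noncomputable def stripMoment : ℝ := ∫ s, stripKernel s * |s| ^ (3 / 4 : ℝ)

theorem stripMoment_nonneg : 0 ≤ stripMoment :=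
  integral_nonneg fun s => mul_nonneg (stripKernel_nonneg s) (by positivity)

/-- The residual of a packet, up to the phase `e^{iξx}`. -/
noncomputable def envelope (ξ w x : ℝ) : ℂ :=
  ∫ s, (stripKernel s : ℂ) * (wave ξ s * ((tent w x - tent w (x + s) : ℝ) : ℂ))

theorem integrable_envelope {ξ w : ℝ} (hw : 0 < w) (x : ℝ) : Integrable fun s =>
    (stripKernel s : ℂ) * (wave ξ s * ((tent w x - tent w (x + s) : ℝ) : ℂ)) := by
  refine integrable_stripKernel_mul (C := 1) ((continuous_wave ξ).mul
    (Complex.continuous_ofReal.comp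
      (continuous_const.sub ((continuous_tent w).comp (by fun_prop))))) fun s => ?_
  rw [norm_mul, norm_wave, one_mul, Complex.norm_real]
  exact abs_tent_sub_le_one hw _ _

theorem norm_envelope_le {ξ w : ℝ} (hw : 0 < w) (x : ℝ) :
    ‖envelope ξ w x‖ ≤ w ^ (-(3 / 4) : ℝ) * stripMoment := by
  rw [stripMoment, ← integral_const_mul]
  refine norm_integral_le_of_norm_le (integrable_stripKernel_mul_rpow.const_mul _)
    (Eventually.of_forall fun s => ?_)
  rw [norm_mul, norm_mul, norm_wave, one_mul, Complex.norm_real, Complex.norm_real,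
    Real.norm_of_nonneg (stripKernel_nonneg s), Real.norm_eq_abs]
  have := abs_tent_sub_le_rpow hw x (x + s)
  rw [show x - (x + s) = -s by ring, abs_neg] at this
  nlinarith [mul_le_mul_of_nonneg_left this (stripKernel_nonneg s)]

/-- Here the two tent differences are compared at fixed `s`, so only the total mass `1/2` of the
kernel is needed and the full rate `1/w` results. -/
theorem norm_envelope_sub_le {ξ w : ℝ} (hw : 0 < w) (x z : ℝ) :
    ‖envelope ξ w x - envelope ξ w z‖ ≤ |x - z| / w := by
  rw [envelope, envelope, ← integral_sub (integrable_envelope hw x) (integrable_envelope hw z)]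
  have h1 : |x - z| / w = ∫ s, stripKernel s * (2 * (|x - z| / w)) := by
    rw [integral_mul_const, integral_stripKernel]; ring
  rw [h1]
  refine norm_integral_le_of_norm_le (integrable_stripKernel.mul_const _)
    (Eventually.of_forall fun s => ?_)
  rw [← mul_sub, ← mul_sub, norm_mul, norm_mul, norm_wave, one_mul, ← Complex.ofReal_sub,
    Complex.norm_real, Complex.norm_real, Real.norm_of_nonneg (stripKernel_nonneg s),
    Real.norm_eq_abs]
  refine mul_le_mul_of_nonneg_left ?_ (stripKernel_nonneg s)
  rw [show tent w x - tent w (x + s) - (tent w z - tent w (z + s)) =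
    (tent w x - tent w z) - (tent w (x + s) - tent w (z + s)) by ring]
  refine (abs_sub _ _).trans ?_
  have h2 := abs_tent_sub_le hw x z
  have h3 := abs_tent_sub_le hw (x + s) (z + s)
  rw [add_sub_add_right_eq_sub] at h3
  linarith

/-- Writing `λ` as the integral of kernel times wave and factoring out `e^{iξx}` leaves only
differences of the tent under the integral. -/
theorem packet_residual_eq {lam ξ w : ℝ} (hw : 0 < w)
    (hξ : ∫ s, (stripKernel s : ℂ) * wave ξ s = lam) (x : ℝ) :
    lam * packet ξ w x - ∫ t, (stripKernel (t - x) : ℂ) * packet ξ w t =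
      wave ξ x * envelope ξ w x := by
  have h1 : ∫ t, (stripKernel (t - x) : ℂ) * packet ξ w t =
      ∫ s, (stripKernel s : ℂ) * packet ξ w (x + s) := by
    rw [← integral_add_left_eq_self _ x]
    simp
  have i1 : Integrable fun s => (stripKernel s : ℂ) * packet ξ w (x + s) :=
    integrable_stripKernel_mul ((continuous_packet ξ w).comp (by fun_prop))
      fun s => norm_packet_le_one hw _
  have i2 : Integrable fun s => (stripKernel s : ℂ) * wave ξ s * packet ξ w x :=
    (integrable_stripKernel_mul (continuous_wave ξ) fun s => (norm_wave ξ s).le).mul_const _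
  rw [h1, ← hξ, ← integral_mul_const, ← integral_sub i2 i1, envelope, ← integral_const_mul]
  congr 1; ext s
  rw [packet, packet, wave_add]
  push_cast; ring

theorem norm_packet_residual_le {lam ξ w : ℝ} (hw : 0 < w)
    (hξ : ∫ s, (stripKernel s : ℂ) * wave ξ s = lam) (x : ℝ) :
    ‖lam * packet ξ w x - ∫ t, (stripKernel (t - x) : ℂ) * packet ξ w t‖ ≤
      w ^ (-(3 / 4) : ℝ) * stripMoment := by
  rw [packet_residual_eq hw hξ, norm_mul, norm_wave, one_mul]
  exact norm_envelope_le hw x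

theorem norm_packet_residual_sub_le {lam ξ w : ℝ} (hw : 0 < w)
    (hξ : ∫ s, (stripKernel s : ℂ) * wave ξ s = lam) (x z : ℝ) :
    ‖(lam * packet ξ w x - ∫ t, (stripKernel (t - x) : ℂ) * packet ξ w t) -
      (lam * packet ξ w z - ∫ t, (stripKernel (t - z) : ℂ) * packet ξ w t)‖ ≤
      (|ξ| * (w ^ (-(3 / 4) : ℝ) * stripMoment) + 1 / w) * |x - z| := by
  rw [packet_residual_eq hw hξ, packet_residual_eq hw hξ,
    show wave ξ x * envelope ξ w x - wave ξ z * envelope ξ w z =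
      (wave ξ x - wave ξ z) * envelope ξ w x + wave ξ z * (envelope ξ w x - envelope ξ w z) by ring]
  refine (norm_add_le _ _).trans ?_
  rw [norm_mul, norm_mul, norm_wave, one_mul, add_mul]
  refine add_le_add ?_ ((norm_envelope_sub_le hw x z).trans_eq (by ring))
  calc ‖wave ξ x - wave ξ z‖ * ‖envelope ξ w x‖
      ≤ (|ξ| * |x - z|) * (w ^ (-(3 / 4) : ℝ) * stripMoment) :=
        mul_le_mul (norm_wave_sub_le ξ x z) (norm_envelope_le hw x) (norm_nonneg _) (by positivity)
    _ = _ := by ring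

/-! ### The sides of a flat piece of the boundary -/

theorem convex_box {I J : Set ℝ} (hI : Convex ℝ I) (hJ : Convex ℝ J) :
    Convex ℝ {x : Plane | x 0 ∈ I ∧ x 1 ∈ J} :=
  fun _ hx _ hy _ _ ha hb hab => ⟨hI hx.1 hy.1 ha hb hab, hJ hx.2 hy.2 ha hb hab⟩

theorem flat_side_mem_or_notMem {Ω : Set Plane} (hΩ : IsOpen Ω) {h w d σ : ℝ}
    (hσ : σ = 1 ∨ σ = -1)
    (hfr : ∀ x ∈ frontier Ω, |x 0| < w → x 1 ≠ h → d ≤ |x 1 - h|) :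
    (∀ x : Plane, |x 0| < w → 0 < σ * (x 1 - h) → σ * (x 1 - h) < d → x ∈ Ω) ∨
      ∀ x : Plane, |x 0| < w → 0 < σ * (x 1 - h) → σ * (x 1 - h) < d → x ∉ Ω := by
  have hJ : Convex ℝ {s : ℝ | 0 < σ * (s - h) ∧ σ * (s - h) < d} := by
    have : {s : ℝ | 0 < σ * (s - h) ∧ σ * (s - h) < d} =
        (fun s => σ * s + -(σ * h)) ⁻¹' Set.Ioo 0 d := by
      ext s; simp only [Set.mem_ofPred_eq, Set.mem_preimage, Set.mem_Ioo]; ring_nf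
    rw [this]
    intro x hx y hy a b ha hb hab
    have := convex_Ioo (0 : ℝ) d hx hy ha hb hab
    have e : σ * (a • x + b • y) + -(σ * h) = a • (σ * x + -(σ * h)) + b • (σ * y + -(σ * h)) := by
      simp only [smul_eq_mul]; linear_combination (σ * h) * hab
    rw [Set.mem_preimage, e]; exact this
  rcases subset_or_disjoint_of_convex hΩ (convex_box (convex_Ioo (-w) w) hJ) (fun x hx hxf => by
    have hlt : |x 1 - h| < d := by
      rw [abs_lt]; rcases hσ with rfl | rfl <;> constructor <;> linarith [hx.2.1, hx.2.2]
    have hne : x 1 ≠ h := fun he => by have := hx.2.1; rw [he] at this; simp at this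
    exact absurd (hfr x hxf (abs_lt.2 hx.1) hne) (not_le.2 hlt)) with H | H
  · exact Or.inl fun x h0 h1 h2 => H x ⟨abs_lt.1 h0, h1, h2⟩
  · exact Or.inr fun x h0 h1 h2 => H x ⟨abs_lt.1 h0, h1, h2⟩

/-- Each side of the segment is wholly inside or wholly outside `Ω`. Both outside is impossible at a
frontier point; both inside leaves no normal, and then the default value `0` of `outwardNormal`
gives `c = 0`. Thus openness suffices, and the orientation need not be known. -/
theorem exists_outwardNormal_flat {Ω : Set Plane} (hΩ : IsOpen Ω) {h w d : ℝ} (hw : 0 < w)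
    (hd : 0 < d) (hseg : ∀ t, |t| < w → horizontal h t ∈ frontier Ω)
    (hfr : ∀ x ∈ frontier Ω, |x 0| < w → x 1 ≠ h → d ≤ |x 1 - h|) :
    ∃ c : ℝ, ∀ t, |t| < w → outwardNormal Ω (horizontal h t) = horizontal c 0 := by
  rcases flat_side_mem_or_notMem hΩ (Or.inl rfl) hfr with hU | hU <;>
    rcases flat_side_mem_or_notMem hΩ (Or.inr rfl) hfr with hV | hV
  · refine ⟨0, fun t ht => ?_⟩
    rw [outwardNormal_flat_eq_zero ht hd fun x h0 h1 h2 => ?_]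
    · ext i; fin_cases i <;> simp
    · rcases lt_or_gt_of_ne h1 with h1 | h1
      · rw [abs_of_neg (by linarith)] at h2
        exact hV x h0 (by linarith) (by linarith)
      · rw [abs_of_pos (by linarith)] at h2
        exact hU x h0 (by linarith) (by linarith)
  · exact ⟨-1, fun t ht => outwardNormal_flat (Or.inr rfl) ht hd hV (by simpa using hU)⟩
  · exact ⟨1, fun t ht => outwardNormal_flat (Or.inl rfl) ht hd hU hV⟩
  · obtain ⟨x, h0, h1, h2, hx⟩ := exists_mem_near_flat hΩ (w := w) (d := d) (h := h) (t := 0)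
      (by simpa using hw) hd (hseg 0 (by simpa using hw))
    rcases lt_or_gt_of_ne h1 with h1 | h1
    · rw [abs_of_neg (by linarith)] at h2
      exact absurd hx (hV x h0 (by linarith) (by linarith))
    · rw [abs_of_pos (by linarith)] at h2
      exact absurd hx (hU x h0 (by linarith) (by linarith))

theorem outwardNormal_flat_of_exterior {Ω : Set Plane} (hΩ : IsOpen Ω) {h w d σ t : ℝ}
    (hσ : σ = 1 ∨ σ = -1) (hd : 0 < d) (ht : |t| < w)
    (hseg : horizontal h t ∈ frontier Ω)
    (hfr : ∀ x ∈ frontier Ω, |x 0| < w → x 1 ≠ h → d ≤ |x 1 - h|)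
    (hout : ∀ x : Plane, |x 0| < w → 0 < σ * (x 1 - h) → x ∉ Ω) :
    outwardNormal Ω (horizontal h t) = horizontal σ 0 := by
  have hσ' : -σ = 1 ∨ -σ = -1 := by rcases hσ with rfl | rfl <;> simp
  refine outwardNormal_flat hσ ht hd (fun x h0 h1 _ => hout x h0 h1) ?_
  refine (flat_side_mem_or_notMem hΩ hσ' hfr).resolve_right fun hV => ?_
  obtain ⟨x, h0, h1, h2, hx⟩ := exists_mem_near_flat hΩ (w := w) (d := d) (h := h) ht hd hseg
  have h1' : σ * (x 1 - h) ≠ 0 :=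
    mul_ne_zero (by rcases hσ with rfl | rfl <;> norm_num) (sub_ne_zero.2 h1)
  rcases lt_or_gt_of_ne h1' with h3 | h3
  · refine hV x h0 (by linarith) ?_ hx
    rcases hσ with rfl | rfl <;> linarith [(abs_lt.1 h2).1, (abs_lt.1 h2).2]
  · exact hout x h0 h3 hx

/-! ### Geometry of thin domains -/

theorem IsSimpleCurve.isCompact {Γ : Set Plane} {a b : Plane} (h : IsSimpleCurve Γ a b) :
    IsCompact Γ := by
  obtain ⟨γ, -, rfl⟩ := h
  exact isCompact_range γ.continuous

section ThinDomain

variable {Γl Γr Ω : Set Plane} {R : ℝ}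

theorem isCompact_shortSides (hl : IsCompact Γl) (hr : IsCompact Γr) :
    IsCompact (shortSides Γl Γr R) :=
  (hl.image (by fun_prop)).union (hr.image (by fun_prop))

theorem exists_shortSides_bound (hl : IsCompact Γl) (hr : IsCompact Γr) :
    ∃ D : ℝ, 0 ≤ D ∧ ∀ R : ℝ, ∀ x ∈ shortSides Γl Γr R, R - D ≤ |x 0| ∧ |x 1| ≤ D := by
  obtain ⟨D, hD⟩ := (hl.union hr).isBounded.exists_norm_le
  refine ⟨max D 0, le_max_right _ _, fun R x hx => ?_⟩
  have key : ∀ p ∈ Γl ∪ Γr, |p 0| ≤ max D 0 ∧ |p 1| ≤ max D 0 := fun p hp =>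
    ⟨((PiLp.norm_apply_le p 0).trans (hD p hp)).trans (le_max_left _ _),
      ((PiLp.norm_apply_le p 1).trans (hD p hp)).trans (le_max_left _ _)⟩
  rcases hx with ⟨p, hp, rfl⟩ | ⟨p, hp, rfl⟩
  · have := key p (Or.inl hp)
    refine ⟨?_, by simpa using this.2⟩
    simp only [PiLp.add_apply, Matrix.cons_val_zero]
    linarith [neg_le_abs (p 0 + -R), le_abs_self (p 0)]
  · have := key p (Or.inr hp)
    refine ⟨?_, by simpa using this.2⟩
    simp only [PiLp.add_apply, Matrix.cons_val_zero]
    linarith [le_abs_self (p 0 + R), neg_le_abs (p 0)]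

theorem horizontal_mem_longSides {σ t : ℝ} (hσ : σ = 1 ∨ σ = -1) (ht : |t| ≤ R) :
    horizontal σ t ∈ longSides R := by
  rcases hσ with rfl | rfl
  · exact Or.inl ⟨by simpa using ht, by simp⟩
  · exact Or.inr ⟨by simpa using ht, by simp⟩

theorem IsThinDomain.horizontal_mem_frontier (hΩ : IsThinDomain Γl Γr R Ω) {σ t : ℝ}
    (hσ : σ = 1 ∨ σ = -1) (ht : |t| ≤ R) : horizontal σ t ∈ frontier Ω := by
  rw [hΩ.frontier_eq]; exact Or.inl (horizontal_mem_longSides hσ ht)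

theorem IsThinDomain.abs_le_or_mem_shortSides (hΩ : IsThinDomain Γl Γr R Ω) {x : Plane}
    (hx : x ∈ frontier Ω) : (|x 0| ≤ R ∧ (x 1 = 1 ∨ x 1 = -1)) ∨ x ∈ shortSides Γl Γr R := by
  rw [hΩ.frontier_eq] at hx
  rcases hx with (⟨h0, h1⟩ | ⟨h0, h1⟩) | hx
  · exact Or.inl ⟨h0, Or.inl h1⟩
  · exact Or.inl ⟨h0, Or.inr h1⟩
  · exact Or.inr hx

/-- The length of the boundary of a thin domain grows linearly in `R`. -/
theorem exists_hausdorffMeasure_frontier_le {R₁ : ℝ} {Ω₁ : Set Plane}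
    (hΩ₁ : IsThinDomain Γl Γr R₁ Ω₁) :
    ∃ S : ℝ, 0 ≤ S ∧ ∀ (R : ℝ) (Ω : Set Plane), 0 ≤ R → IsThinDomain Γl Γr R Ω →
      Measure.hausdorffMeasure 1 (frontier Ω) ≤ ENNReal.ofReal (4 * R + S) := by
  have htr : ∀ (a : Plane) (Γ : Set Plane), Measure.hausdorffMeasure 1 ((fun x => x + a) '' Γ) =
      Measure.hausdorffMeasure 1 Γ := fun a Γ =>
    (isometry_add_right a).hausdorffMeasure_image (Or.inl zero_le_one) Γ
  have hfin := hΩ₁.lipschitz.hausdorffMeasure_frontier_lt_top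
  have hshort : shortSides Γl Γr R₁ ⊆ frontier Ω₁ := by
    rw [hΩ₁.frontier_eq]; exact Set.subset_union_right
  -- Rectifiability of the curves is not assumed: it is inherited from the finite boundary length of
  -- the single domain `Ω₁`, translations being isometries.
  have hl : Measure.hausdorffMeasure 1 Γl < ∞ := by
    rw [← htr !₂[-R₁, 0]]
    exact (measure_mono (Set.subset_union_left.trans hshort)).trans_lt hfin
  have hr : Measure.hausdorffMeasure 1 Γr < ∞ := by
    rw [← htr !₂[R₁, 0]]
    exact (measure_mono (Set.subset_union_right.trans hshort)).trans_lt hfin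
  refine ⟨(Measure.hausdorffMeasure 1 Γl).toReal + (Measure.hausdorffMeasure 1 Γr).toReal,
    by positivity, fun R Ω hR hΩ => ?_⟩
  have hside : ∀ σ : ℝ, Measure.hausdorffMeasure 1 {x : Plane | |x 0| ≤ R ∧ x 1 = σ} ≤
      ENNReal.ofReal (2 * R) := fun σ => by
    have : {x : Plane | |x 0| ≤ R ∧ x 1 = σ} ⊆ horizontal σ '' Set.Icc (-R) R := fun x hx =>
      ⟨x 0, abs_le.1 hx.1, by rw [← hx.2, ← eq_horizontal]⟩
    refine (measure_mono this).trans ?_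
    rw [hausdorffMeasure_horizontal_image, Real.volume_Icc]
    exact ENNReal.ofReal_le_ofReal (by linarith)
  rw [hΩ.frontier_eq, ENNReal.ofReal_add (by positivity) (by positivity),
    ENNReal.ofReal_add (by positivity) (by positivity), ENNReal.ofReal_toReal hl.ne,
    ENNReal.ofReal_toReal hr.ne, show 4 * R = 2 * R + 2 * R by ring,
    ENNReal.ofReal_add (by positivity) (by positivity)]
  refine (measure_union_le _ _).trans (add_le_add ?_ ?_)
  · exact (measure_union_le _ _).trans (add_le_add (hside 1) (hside (-1)))
  · refine (measure_union_le _ _).trans ?_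
    rw [htr, htr]

/-! ### Quasimodes -/

/-- `φ` is an admissible density in `H^{1/2}(∂Ω)` for the operator `λ - K`. -/
def IsAdmissible (Ω : Set Plane) (lam : ℝ) (φ : Plane → ℂ) : Prop :=
  MemHHalf Ω φ ∧ hHalfNorm Ω φ ≠ 0 ∧ (∀ᵐ x ∂(arcLength Ω), NPExists Ω φ x) ∧
    MemHHalf Ω (fun x => (lam : ℂ) * φ x - npOperator Ω φ x)

theorem norm_layer_le_one {h : ℝ} {f : ℝ → ℂ} (hf1 : ∀ t, ‖f t‖ ≤ 1) (x : Plane) :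
    ‖layer h f x‖ ≤ 1 := by
  by_cases hx : x 1 = h
  · rw [layer_of_eq hx]; exact hf1 _
  · rw [layer_of_ne hx]; simp

/-- Leaving the line makes the density jump by at most `1`, but only across a distance at least `d`;
this accounts for the summand `1 / d`. -/
theorem norm_layer_sub_le {h w d L : ℝ} (hd : 0 < d) (hL : 0 ≤ L) {f : ℝ → ℂ}
    (hf1 : ∀ t, ‖f t‖ ≤ 1) (hsupp : ∀ t, w ≤ |t| → f t = 0)
    (hlip : ∀ s t, ‖f s - f t‖ ≤ L * |s - t|) {A : Set Plane}
    (hfar : ∀ x ∈ A, x 1 ≠ h → ∀ t, |t| < w → d ≤ dist x (horizontal h t)) :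
    ∀ x ∈ A, ∀ z ∈ A, ‖layer h f x - layer h f z‖ ≤ (L + 1 / d) * dist x z := by
  have key : ∀ x z : Plane, x 1 = h → z ∈ A → z 1 ≠ h → ‖f (x 0)‖ ≤ 1 / d * dist x z :=
    fun x z hx hz hzh => by
      by_cases hw : |x 0| < w
      · have h1 := hfar z hz hzh _ hw
        rw [← hx, ← eq_horizontal, dist_comm] at h1
        refine (hf1 _).trans ?_
        rw [div_mul_eq_mul_div, one_mul, le_div_iff₀ hd]; linarith
      · rw [hsupp _ (not_lt.1 hw), norm_zero]; positivity
  intro x hx z hz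
  have h0 : 0 ≤ L * dist x z := by positivity
  have h1 : 0 ≤ 1 / d * dist x z := by positivity
  rw [add_mul]
  by_cases hxh : x 1 = h <;> by_cases hzh : z 1 = h
  · rw [layer_of_eq hxh, layer_of_eq hzh]
    have h2 := (hlip (x 0) (z 0)).trans
      (mul_le_mul_of_nonneg_left (abs_coord_sub_le_dist x z 0) hL)
    linarith
  · rw [layer_of_eq hxh, layer_of_ne hzh, sub_zero]
    linarith [key x z hxh hz hzh]
  · rw [layer_of_ne hxh, layer_of_eq hzh, zero_sub, norm_neg, dist_comm]
    rw [dist_comm] at h0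
    linarith [key z x hzh hx hxh]
  · rw [layer_of_ne hxh, layer_of_ne hzh, sub_zero, norm_zero]; linarith

/-- A tent (frequency `0`) on an isolated flat piece works for every `lam`: both the density and its
potential are bounded and Lipschitz on the frontier. -/
theorem exists_isAdmissible_of_flat (hΩ : IsBoundedLipschitzDomain Ω) {h w d : ℝ} (hw : 0 < w)
    (hd : 0 < d) (hseg : ∀ t, |t| < w → horizontal h t ∈ frontier Ω)
    (hfar : ∀ x ∈ frontier Ω, x 1 ≠ h → ∀ t, |t| < w → d ≤ dist x (horizontal h t)) (lam : ℝ) :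
    ∃ φ, IsAdmissible Ω lam φ := by
  obtain ⟨c, hc⟩ := exists_outwardNormal_flat hΩ.isOpen hw hd hseg fun x hx h0 h1 => by
    have h2 := hfar x hx h1 _ h0
    have h3 : dist x (horizontal h (x 0)) = |x 1 - h| := by
      rw [← abs_of_nonneg (dist_nonneg (x := x)), ← sq_eq_sq_iff_abs_eq_abs, dist_sq_eq]; simp
    rwa [h3] at h2
  set f := packet 0 w with hf
  have hfc : Continuous f := continuous_packet 0 w
  have hf1 : ∀ t, ‖f t‖ ≤ 1 := norm_packet_le_one hw
  have hsupp : ∀ t, w ≤ |t| → f t = 0 := fun t ht => packet_eq_zero hw ht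
  have hL : (0 : ℝ) ≤ |0| + 1 / w := by positivity
  have hlay := norm_layer_sub_le hd hL hf1 hsupp (norm_packet_sub_le hw) hfar
  have hNP := hasNPIntegral_layer hfc hsupp hseg hc
  set k : ℂ := ((c / (2 * Real.pi) : ℝ) : ℂ) with hk
  have hor : ∀ x ∈ frontier Ω, ∀ t, |t| < w → x 1 = h ∨ d ≤ dist x (horizontal h t) :=
    fun x hx t ht => by
      by_cases hxh : x 1 = h
      · exact Or.inl hxh
      · exact Or.inr (hfar x hx hxh t ht)
  have hpot : ∀ x ∈ frontier Ω, ‖potential h f x‖ ≤ 2 * w * (1 / d) := fun x hx => by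
    refine norm_potential_le hw.le hf1 hsupp fun t ht => ?_
    rcases hor x hx t ht with h1 | h1
    · rw [flatKernel_of_eq h1, abs_zero]; positivity
    · have hpos : 0 < dist x (horizontal h t) := hd.trans_le h1
      refine (abs_flatKernel_le hpos le_rfl).trans ?_
      have h2 : |h - x 1| ≤ dist x (horizontal h t) := by
        have := abs_coord_sub_le_dist x (horizontal h t) 1
        rwa [horizontal_one, abs_sub_comm] at this
      calc |h - x 1| / dist x (horizontal h t) ^ 2
          ≤ dist x (horizontal h t) / dist x (horizontal h t) ^ 2 := by gcongr
        _ = 1 / dist x (horizontal h t) := by field_simp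
        _ ≤ 1 / d := by gcongr
  have hpotlip : ∀ x ∈ frontier Ω, ∀ z ∈ frontier Ω,
      ‖potential h f x - potential h f z‖ ≤ 2 * w * (dist x z / d ^ 2) := fun x hx z hz =>
    norm_potential_sub_le hw.le hfc hf1 hsupp fun t ht =>
      abs_flatKernel_sub_le_of_line hd (hor x hx t ht) (hor z hz t ht)
  refine ⟨layer h f, ?_, ?_, Eventually.of_forall fun x => (hNP x).npExists, ?_⟩
  · refine memHHalf_of_lipschitz (L := 1 + (|0| + 1 / w + 1 / d)) hΩ (fun x _ => ?_)
      fun x hx z hz => ?_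
    · refine (norm_layer_le_one hf1 x).trans ?_
      have : 0 ≤ 1 / d := by positivity
      linarith
    · refine (hlay x hx z hz).trans ?_
      exact mul_le_mul_of_nonneg_right (by linarith) dist_nonneg
  · have := le_hHalfNorm (Ω := Ω) (φ := layer h f) (h := h) (w := w)
      (fun t ht => hseg t (by linarith)) fun t ht => by
        rw [layer_of_eq (horizontal_one h t), horizontal_zero, hf, norm_packet]
        exact half_le_tent hw ht
    refine ((ENNReal.rpow_pos ?_ ENNReal.ofReal_ne_top).trans_le this).ne'
    rw [ENNReal.ofReal_pos]; positivity
  · refine memHHalf_of_lipschitz (L := |lam| * (1 + (|0| + 1 / w + 1 / d)) +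
      ‖k‖ * (2 * w * (1 / d) + 2 * w * (1 / d ^ 2))) hΩ (fun x hx => ?_) fun x hx z hz => ?_
    · rw [(hNP x).npOperator_eq]
      refine (norm_sub_le _ _).trans ?_
      rw [norm_mul, norm_mul, Complex.norm_real, Real.norm_eq_abs]
      gcongr
      · refine (norm_layer_le_one hf1 x).trans ?_
        have : 0 ≤ 1 / d := by positivity
        linarith
      · refine (hpot x hx).trans ?_
        have : 0 ≤ 2 * w * (1 / d ^ 2) := by positivity
        linarith
    · rw [(hNP x).npOperator_eq, (hNP z).npOperator_eq, show
        (lam : ℂ) * layer h f x - k * potential h f x - (lam * layer h f z - k * potential h f z) =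
          lam * (layer h f x - layer h f z) - k * (potential h f x - potential h f z) by ring]
      refine (norm_sub_le _ _).trans ?_
      rw [norm_mul, norm_mul, Complex.norm_real, Real.norm_eq_abs, add_mul, mul_assoc, mul_assoc]
      gcongr
      · refine (hlay x hx z hz).trans ?_
        exact mul_le_mul_of_nonneg_right (by linarith) dist_nonneg
      · refine (hpotlip x hx z hz).trans ?_
        have : 0 ≤ 2 * w * (1 / d) * dist x z := by positivity
        rw [add_mul]
        calc 2 * w * (dist x z / d ^ 2) = 2 * w * (1 / d ^ 2) * dist x z := by ring
          _ ≤ _ := by linarith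

theorem IsThinDomain.exists_isAdmissible (hΩ : IsThinDomain Γl Γr R Ω) (hl : IsCompact Γl)
    (hr : IsCompact Γr) (hR : 1 ≤ R) (lam : ℝ) : ∃ φ, IsAdmissible Ω lam φ := by
  -- Long and short sides meet only at corners, whose abscissas `±R` are nonzero.
  have hnot : horizontal 1 0 ∉ shortSides Γl Γr R := fun hs => by
    have h1 := hΩ.inter_subset ⟨horizontal_mem_longSides (Or.inl rfl) (by simp; linarith), hs⟩
    have h2 : ∀ a b : ℝ, horizontal 1 0 = !₂[a, b] → a = 0 := fun a b hab => by
      have := congrArg (fun x : Plane => x 0) hab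
      simpa using this.symm
    simp only [Set.mem_insert_iff, Set.mem_singleton_iff] at h1
    rcases h1 with h1 | h1 | h1 | h1 <;> linarith [h2 _ _ h1]
  obtain ⟨ρ, hρ, hball⟩ := Metric.isOpen_iff.1
    (isCompact_shortSides (R := R) hl hr).isClosed.isOpen_compl _ hnot
  refine exists_isAdmissible_of_flat hΩ.lipschitz (h := 1) (w := min (ρ / 2) 1)
    (d := min (ρ / 2) 1) (by positivity) (by positivity) (fun t ht => ?_) (fun x hx hx1 t ht => ?_)
    lam
  · exact hΩ.horizontal_mem_frontier (Or.inl rfl) ((ht.le.trans (min_le_right _ _)).trans hR)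
  · rcases hΩ.abs_le_or_mem_shortSides hx with ⟨-, h1⟩ | hs
    · refine (min_le_right _ _).trans ?_
      have h2 := abs_coord_sub_le_dist x (horizontal 1 t) 1
      rw [h1.resolve_left hx1, horizontal_one] at h2
      norm_num at h2
      linarith
    · refine (min_le_left _ _).trans ?_
      have h2 : ρ ≤ dist x (horizontal 1 0) := by
        by_contra! hlt
        exact hball (Metric.mem_ball.2 hlt) hs
      have h3 : dist (horizontal 1 t) (horizontal 1 0) < ρ / 2 := by
        rw [(isometry_horizontal 1).dist_eq, Real.dist_eq, sub_zero]
        exact ht.trans_le (min_le_left _ _)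
      linarith [dist_triangle x (horizontal 1 t) (horizontal 1 0)]

end ThinDomain

section Quasimode

variable {Γl Γr Ω : Set Plane}

theorem IsThinDomain.eq_one_or_eq_neg_one_of_mem_frontier {R w : ℝ} (hΩ : IsThinDomain Γl Γr R Ω)
    (hshort : ∀ x ∈ shortSides Γl Γr R, w ≤ |x 0|) {x : Plane} (hx : x ∈ frontier Ω)
    (hxw : |x 0| < w) : x 1 = 1 ∨ x 1 = -1 := by
  rcases hΩ.abs_le_or_mem_shortSides hx with h | h
  · exact h.2
  · exact absurd (hshort x h) (not_le.2 hxw)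

/-- Away from the short sides, the domain lies between the long sides. -/
theorem IsThinDomain.outwardNormal_horizontal {R w σ t : ℝ} (hΩ : IsThinDomain Γl Γr R Ω)
    (hwR : w ≤ R) (hshort : ∀ x ∈ shortSides Γl Γr R, w ≤ |x 0|) (hσ : σ = 1 ∨ σ = -1)
    (ht : |t| < w) : outwardNormal Ω (horizontal σ t) = horizontal σ 0 := by
  have hw : 0 < w := (abs_nonneg t).trans_lt ht
  have hσσ : σ * σ = 1 := by rcases hσ with rfl | rfl <;> norm_num
  have hfr : ∀ x ∈ frontier Ω, |x 0| < w → x 1 ≠ σ → 2 ≤ |x 1 - σ| := fun x hx h0 h1 => by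
    have := hΩ.eq_one_or_eq_neg_one_of_mem_frontier hshort hx h0
    rcases hσ with rfl | rfl
    · rw [this.resolve_left h1]; norm_num
    · rw [this.resolve_right h1]; norm_num
  refine outwardNormal_flat_of_exterior hΩ.lipschitz.isOpen hσ two_pos ht
    (hΩ.horizontal_mem_frontier hσ (ht.le.trans hwR)) hfr ?_
  have hJ : Convex ℝ {s : ℝ | 0 < σ * (s - σ)} := by
    rcases hσ with rfl | rfl
    · simpa [Set.Ioi_def] using convex_Ioi (1 : ℝ)
    · have : {s : ℝ | 0 < -1 * (s - -1)} = Set.Iio (-1) := by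
        ext s; constructor <;> intro h
        · have h : 0 < -1 * (s - -1) := h
          exact Set.mem_Iio.2 (by linarith)
        · have h : s < -1 := h
          exact (by linarith : 0 < -1 * (s - -1))
      rw [this]; exact convex_Iio _
  rcases subset_or_disjoint_of_convex hΩ.lipschitz.isOpen (convex_box (convex_Ioo (-w) w) hJ)
    (fun x hx hxf => by
      have h1 : 0 < σ * (x 1 - σ) := hx.2
      rcases hΩ.eq_one_or_eq_neg_one_of_mem_frontier hshort hxf (abs_lt.2 hx.1) with h | h <;>
        rcases hσ with rfl | rfl <;> rw [h] at h1 <;> norm_num at h1) with H | H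
  -- The half-strip beyond the long side misses the frontier; it is unbounded, so it cannot lie in
  -- `Ω`.
  · obtain ⟨C, hC⟩ := hΩ.lipschitz.isBounded.exists_norm_le
    have hmem : horizontal (σ * (|C| + 2)) 0 ∈ Ω := by
      refine H _ ⟨by simpa using hw, ?_⟩
      have : 0 < σ * (σ * (|C| + 2) - σ) := by
        rw [show σ * (σ * (|C| + 2) - σ) = (σ * σ) * (|C| + 1) by ring, hσσ]; positivity
      simpa using this
    have h1 := (PiLp.norm_apply_le (horizontal (σ * (|C| + 2)) 0) 1).trans (hC _ hmem)
    rw [horizontal_one, Real.norm_eq_abs, abs_mul, abs_of_pos (by positivity : 0 < |C| + 2)] at h1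
    have hσ1 : |σ| = 1 := by rcases hσ with rfl | rfl <;> simp
    rw [hσ1] at h1
    linarith [le_abs_self C]
  · exact fun x h0 h1 => H x ⟨abs_lt.1 h0, h1⟩

/-- The Neumann–Poincaré potential of the same profile `f` on both long sides. -/
noncomputable def twoSidedPotential (f : ℝ → ℂ) (x : Plane) : ℂ :=
  ((1 / (2 * Real.pi) : ℝ) : ℂ) * potential 1 f x +
    ((-1 / (2 * Real.pi) : ℝ) : ℂ) * potential (-1) f x

/-- The sign of the normal cancels the sign of `σ - x 1 = 2σ`. Both lines therefore act by the same
positive kernel, which is why the same profile is placed on both. -/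
theorem mul_potential_of_parallel {σ : ℝ} (hσ : σ = 1 ∨ σ = -1) (f : ℝ → ℂ) {x : Plane}
    (hx : x 1 = -σ) : ((σ / (2 * Real.pi) : ℝ) : ℂ) * potential σ f x =
      ∫ t, (stripKernel (t - x 0) : ℂ) * f t := by
  rw [potential, ← integral_const_mul]
  congr 1; ext t
  rw [← mul_assoc, ← Complex.ofReal_mul]
  congr 2
  have hpi := Real.pi_pos
  rw [flatKernel, stripKernel, hx]
  rcases hσ with rfl | rfl
  · have h1 : 0 < (t - x 0) ^ 2 + (1 - -1) ^ 2 := by positivity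
    have h2 : 0 < 4 + (t - x 0) ^ 2 := by positivity
    field_simp; ring
  · have h1 : 0 < (t - x 0) ^ 2 + (-1 - - -1) ^ 2 := by norm_num; positivity
    have h2 : 0 < 4 + (t - x 0) ^ 2 := by positivity
    field_simp; ring

theorem twoSidedPotential_of_long (f : ℝ → ℂ) {x : Plane} (hx : x 1 = 1 ∨ x 1 = -1) :
    twoSidedPotential f x = ∫ t, (stripKernel (t - x 0) : ℂ) * f t := by
  rw [twoSidedPotential]
  rcases hx with hx | hx
  · rw [potential_of_eq hx, mul_zero, zero_add,
      mul_potential_of_parallel (Or.inr rfl) f (by simpa using hx)]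
  · rw [potential_of_eq hx, mul_zero, add_zero, mul_potential_of_parallel (Or.inl rfl) f hx]

theorem layer_add_layer_of_long (f : ℝ → ℂ) {x : Plane} (hx : x 1 = 1 ∨ x 1 = -1) :
    layer 1 f x + layer (-1) f x = f (x 0) := by
  rcases hx with hx | hx
  · rw [layer_of_eq hx, layer_of_ne (by rw [hx]; norm_num), add_zero]
  · rw [layer_of_ne (by rw [hx]; norm_num), layer_of_eq hx, zero_add]

theorem layer_eq_zero_of_le {h w : ℝ} {f : ℝ → ℂ} (hsupp : ∀ t, w ≤ |t| → f t = 0) {x : Plane}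
    (hx : w ≤ |x 0|) : layer h f x = 0 := by
  by_cases hxh : x 1 = h
  · rw [layer_of_eq hxh, hsupp _ hx]
  · exact layer_of_ne hxh

theorem norm_two_sided_le {A B : ℂ} {C : ℝ} (hA : ‖A‖ ≤ C) (hB : ‖B‖ ≤ C) :
    ‖((1 / (2 * Real.pi) : ℝ) : ℂ) * A + ((-1 / (2 * Real.pi) : ℝ) : ℂ) * B‖ ≤ C := by
  have hC : 0 ≤ C := (norm_nonneg A).trans hA
  have hpi : 1 / (2 * Real.pi) ≤ 1 / 2 := by
    have := Real.pi_gt_three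
    gcongr; linarith
  refine (norm_add_le _ _).trans ?_
  rw [norm_mul, norm_mul, Complex.norm_real, Complex.norm_real, Real.norm_eq_abs, Real.norm_eq_abs,
    neg_div, abs_neg, abs_of_pos (by positivity)]
  have h1 : 1 / (2 * Real.pi) * ‖A‖ ≤ 1 / 2 * C := by gcongr
  have h2 : 1 / (2 * Real.pi) * ‖B‖ ≤ 1 / 2 * C := by gcongr
  linarith

theorem le_dist_horizontal {w ρ h t : ℝ} {x : Plane} (hx : w + ρ ≤ |x 0|) (ht : |t| < w) :
    ρ ≤ dist x (horizontal h t) := by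
  have h1 := abs_coord_sub_le_dist x (horizontal h t) 0
  rw [horizontal_zero] at h1
  linarith [abs_sub_abs_le_abs_sub (x 0) t]

theorem norm_twoSidedPotential_le {f : ℝ → ℂ} {w D : ℝ} (hw : 0 < w) (hf1 : ∀ t, ‖f t‖ ≤ 1)
    (hsupp : ∀ t, w ≤ |t| → f t = 0) {x : Plane} (hx0 : w + w / 2 ≤ |x 0|) (hx1 : |x 1| ≤ D) :
    ‖twoSidedPotential f x‖ ≤ 8 * (1 + D) / w := by
  have key : ∀ h : ℝ, |h| = 1 → ‖potential h f x‖ ≤ 8 * (1 + D) / w := fun h hh => by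
    have := norm_potential_le (h := h) hw.le hf1 hsupp (x := x) (B := (1 + D) / (w / 2) ^ 2)
      fun t ht => by
        refine (abs_flatKernel_le (half_pos hw) (le_dist_horizontal hx0 ht)).trans ?_
        gcongr
        exact (abs_sub _ _).trans (by linarith)
    refine this.trans_eq ?_
    field_simp; ring
  exact norm_two_sided_le (key 1 (by simp)) (key (-1) (by simp))

/-- The margin `w / 4`, smaller than the `w / 2` available on the short sides, leaves room for a
point near a short side to be compared with one on it. -/
theorem norm_twoSidedPotential_sub_le {f : ℝ → ℂ} {w : ℝ} (hw : 0 < w) (hf : Continuous f)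
    (hf1 : ∀ t, ‖f t‖ ≤ 1) (hsupp : ∀ t, w ≤ |t| → f t = 0) {x z : Plane}
    (hx : w + w / 4 ≤ |x 0|) (hz : w + w / 4 ≤ |z 0|) :
    ‖twoSidedPotential f x - twoSidedPotential f z‖ ≤ 32 / w * dist x z := by
  have key : ∀ h : ℝ, ‖potential h f x - potential h f z‖ ≤ 32 / w * dist x z := fun h => by
    refine (norm_potential_sub_le hw.le hf hf1 hsupp (B := dist x z / (w / 4) ^ 2) fun t ht =>
      abs_flatKernel_sub_le (by positivity) (le_dist_horizontal hx ht)
        (le_dist_horizontal hz ht)).trans_eq ?_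
    field_simp; ring
  have := norm_two_sided_le (key 1) (key (-1))
  rw [twoSidedPotential, twoSidedPotential]
  convert this using 2
  ring

/-- The residual `(λ - K) φ` of a packet on both long sides. -/
noncomputable def packetResidual (lam ξ w : ℝ) (x : Plane) : ℂ :=
  lam * (layer 1 (packet ξ w) x + layer (-1) (packet ξ w) x) - twoSidedPotential (packet ξ w) x

theorem packetResidual_of_long {lam ξ w : ℝ} {x : Plane} (hx : x 1 = 1 ∨ x 1 = -1) :
    packetResidual lam ξ w x =
      lam * packet ξ w (x 0) - ∫ t, (stripKernel (t - x 0) : ℂ) * packet ξ w t := by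
  rw [packetResidual, layer_add_layer_of_long _ hx, twoSidedPotential_of_long _ hx]

theorem packetResidual_of_le {lam ξ w : ℝ} (hw : 0 < w) {x : Plane} (hx : w ≤ |x 0|) :
    packetResidual lam ξ w x = -twoSidedPotential (packet ξ w) x := by
  have hsupp : ∀ t, w ≤ |t| → packet ξ w t = 0 := fun t ht => packet_eq_zero hw ht
  rw [packetResidual, layer_eq_zero_of_le hsupp hx, layer_eq_zero_of_le hsupp hx]; simp

/-- The constant in the bounds for the residual of a packet. -/
noncomputable def residualConst (ξ D : ℝ) : ℝ :=
  (|ξ| * stripMoment + 1) + 2 * (stripMoment + 8 * (1 + D)) + 32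

theorem one_div_le_rpow {w : ℝ} (hw : 1 ≤ w) : 1 / w ≤ w ^ (-(3 / 4) : ℝ) := by
  rw [one_div, ← Real.rpow_neg_one]
  exact Real.rpow_le_rpow_of_exponent_le hw (by norm_num)

variable {lam ξ w D : ℝ}

theorem IsThinDomain.norm_packetResidual_le (hΩ : IsThinDomain Γl Γr (2 * w) Ω) (hD : 0 ≤ D)
    (hshort : ∀ x ∈ shortSides Γl Γr (2 * w), 2 * w - D ≤ |x 0| ∧ |x 1| ≤ D)
    (hw : 2 * D + 4 ≤ w) (hξ : ∫ s, (stripKernel s : ℂ) * wave ξ s = lam) {x : Plane}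
    (hx : x ∈ frontier Ω) :
    ‖packetResidual lam ξ w x‖ ≤ (stripMoment + 8 * (1 + D)) * w ^ (-(3 / 4) : ℝ) := by
  have hw0 : 0 < w := by linarith
  have hM := stripMoment_nonneg
  have hβ : 0 < w ^ (-(3 / 4) : ℝ) := Real.rpow_pos_of_pos hw0 _
  rcases hΩ.abs_le_or_mem_shortSides hx with ⟨-, h⟩ | h
  · rw [packetResidual_of_long h]
    refine (norm_packet_residual_le hw0 hξ _).trans ?_
    nlinarith [mul_pos hβ (by linarith : 0 < 8 * (1 + D))]
  · obtain ⟨h0, h1⟩ := hshort x h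
    rw [packetResidual_of_le hw0 (by linarith), norm_neg]
    refine (norm_twoSidedPotential_le hw0 (norm_packet_le_one hw0)
      (fun t ht => packet_eq_zero hw0 ht) (by linarith) h1).trans ?_
    calc 8 * (1 + D) / w = 8 * (1 + D) * (1 / w) := by ring
      _ ≤ 8 * (1 + D) * w ^ (-(3 / 4) : ℝ) := by
          gcongr
          exact one_div_le_rpow (by linarith)
      _ ≤ _ := by gcongr; linarith

theorem IsThinDomain.norm_packetResidual_sub_le (hΩ : IsThinDomain Γl Γr (2 * w) Ω) (hD : 0 ≤ D)
    (hshort : ∀ x ∈ shortSides Γl Γr (2 * w), 2 * w - D ≤ |x 0| ∧ |x 1| ≤ D)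
    (hw : 2 * D + 4 ≤ w) (hξ : ∫ s, (stripKernel s : ℂ) * wave ξ s = lam) {x z : Plane}
    (hx : x ∈ frontier Ω) (hz : z ∈ frontier Ω) :
    ‖packetResidual lam ξ w x - packetResidual lam ξ w z‖ ≤
      residualConst ξ D * w ^ (-(3 / 4) : ℝ) * dist x z := by
  have hw0 : 0 < w := by linarith
  have hM := stripMoment_nonneg
  set β := w ^ (-(3 / 4) : ℝ) with hβdef
  have hβ : 0 < β := Real.rpow_pos_of_pos hw0 _
  have hβw : 1 / w ≤ β := one_div_le_rpow (by linarith)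
  have hξM : 0 ≤ |ξ| * stripMoment := by positivity
  have key : ∀ x ∈ frontier Ω, ∀ z ∈ shortSides Γl Γr (2 * w), z ∈ frontier Ω →
      ‖packetResidual lam ξ w x - packetResidual lam ξ w z‖ ≤
        residualConst ξ D * β * dist x z := fun x hx z hz hzf => by
    obtain ⟨hz0, -⟩ := hshort z hz
    -- At distance at least `1` the sup bound is already a Lipschitz bound. Otherwise `x` too lies
    -- beyond the support by `w / 4`, so only the potential remains at both points.
    rcases le_or_gt 1 (dist x z) with h1 | h1
    · refine (norm_sub_le _ _).trans ?_
      have h2 := hΩ.norm_packetResidual_le hD hshort hw hξ hx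
      have h3 := hΩ.norm_packetResidual_le hD hshort hw hξ hzf
      calc _ ≤ 2 * (stripMoment + 8 * (1 + D)) * β := by linarith
        _ ≤ residualConst ξ D * β := by
            refine mul_le_mul_of_nonneg_right ?_ hβ.le
            rw [residualConst]; linarith
        _ ≤ residualConst ξ D * β * dist x z :=
            le_mul_of_one_le_right (by rw [residualConst]; positivity) h1
    · have h2 : w + w / 4 ≤ |x 0| := by
        have := (abs_coord_sub_le_dist x z 0).trans_lt h1
        rw [abs_sub_comm] at this
        linarith [abs_sub_abs_le_abs_sub (z 0) (x 0)]
      rw [packetResidual_of_le hw0 (by linarith), packetResidual_of_le hw0 (by linarith),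
        neg_sub_neg, norm_sub_rev]
      refine (norm_twoSidedPotential_sub_le hw0 (continuous_packet ξ w) (norm_packet_le_one hw0)
        (fun t ht => packet_eq_zero hw0 ht) h2 (by linarith)).trans ?_
      refine mul_le_mul_of_nonneg_right ?_ dist_nonneg
      calc 32 / w = 32 * (1 / w) := by ring
        _ ≤ 32 * β := by gcongr
        _ ≤ residualConst ξ D * β := by
            refine mul_le_mul_of_nonneg_right ?_ hβ.le
            rw [residualConst]; linarith
  rcases hΩ.abs_le_or_mem_shortSides hz with ⟨-, hzl⟩ | hzs
  · rcases hΩ.abs_le_or_mem_shortSides hx with ⟨-, hxl⟩ | hxs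
    -- On the long sides the residual depends only on the abscissa, so pairs on opposite lines need
    -- no separate treatment.
    · rw [packetResidual_of_long hxl, packetResidual_of_long hzl]
      refine (norm_packet_residual_sub_le hw0 hξ _ _).trans ?_
      refine mul_le_mul ?_ (abs_coord_sub_le_dist x z 0) (abs_nonneg _)
        (mul_nonneg (by rw [residualConst]; positivity) hβ.le)
      calc |ξ| * (β * stripMoment) + 1 / w ≤ |ξ| * (β * stripMoment) + β := by gcongr
        _ = (|ξ| * stripMoment + 1) * β := by ring
        _ ≤ residualConst ξ D * β := by
            refine mul_le_mul_of_nonneg_right ?_ hβ.le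
            rw [residualConst]; linarith
    · rw [norm_sub_rev, dist_comm]; exact key z hz x hxs hx
  · exact key x hx z hzs hz

theorem IsThinDomain.exists_quasimode {S : ℝ} (hΩ : IsThinDomain Γl Γr (2 * w) Ω) (hD : 0 ≤ D)
    (hS : 0 ≤ S) (hshort : ∀ x ∈ shortSides Γl Γr (2 * w), 2 * w - D ≤ |x 0| ∧ |x 1| ≤ D)
    (hw : 2 * D + 4 ≤ w) (hξ : ∫ s, (stripKernel s : ℂ) * wave ξ s = lam)
    (hμ : Measure.hausdorffMeasure 1 (frontier Ω) ≤ ENNReal.ofReal (8 * w + S)) :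
    ∃ φ, IsAdmissible Ω lam φ ∧
      hHalfNorm Ω (fun x => (lam : ℂ) * φ x - npOperator Ω φ x) / hHalfNorm Ω φ ≤
        ENNReal.ofReal (4 * residualConst ξ D * (8 + S) * w ^ (-(1 / 4) : ℝ)) := by
  have hw0 : 0 < w := by linarith
  have hM := stripMoment_nonneg
  set f := packet ξ w with hf
  have hfc : Continuous f := continuous_packet ξ w
  have hf1 : ∀ t, ‖f t‖ ≤ 1 := norm_packet_le_one hw0
  have hsupp : ∀ t, w ≤ |t| → f t = 0 := fun t ht => packet_eq_zero hw0 ht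
  have hsh : ∀ x ∈ shortSides Γl Γr (2 * w), w ≤ |x 0| := fun x hx => by
    linarith [(hshort x hx).1]
  have hseg : ∀ σ : ℝ, (σ = 1 ∨ σ = -1) → ∀ t, |t| < w → horizontal σ t ∈ frontier Ω :=
    fun σ hσ t ht => hΩ.horizontal_mem_frontier hσ (by linarith)
  have hlay : ∀ σ : ℝ, (σ = 1 ∨ σ = -1) → ∀ x, HasNPIntegral Ω (layer σ f) x
      ((σ / (2 * Real.pi) : ℝ) * potential σ f x) := fun σ hσ =>
    hasNPIntegral_layer hfc hsupp (hseg σ hσ) fun t ht =>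
      hΩ.outwardNormal_horizontal (by linarith) hsh hσ ht
  have hNP : ∀ x, HasNPIntegral Ω (fun y => layer 1 f y + layer (-1) f y) x
      (twoSidedPotential f x) := fun x => (hlay 1 (Or.inl rfl) x).add (hlay (-1) (Or.inr rfl) x)
  have hfar : ∀ σ : ℝ, (σ = 1 ∨ σ = -1) → ∀ x ∈ frontier Ω, x 1 ≠ σ → ∀ t, |t| < w →
      2 ≤ dist x (horizontal σ t) := fun σ hσ x hx hxσ t ht => by
    rcases hΩ.abs_le_or_mem_shortSides hx with ⟨-, h1⟩ | h1
    · have h2 := abs_coord_sub_le_dist x (horizontal σ t) 1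
      rw [horizontal_one] at h2
      refine le_trans ?_ h2
      rcases hσ with rfl | rfl
      · rw [h1.resolve_left hxσ]; norm_num
      · rw [h1.resolve_right hxσ]; norm_num
    -- The summand `4` in `2 * D + 4 ≤ w` makes `w / 2 ≥ 2`, the distance between the two lines.
    · exact le_trans (by linarith) (le_dist_horizontal (ρ := w / 2)
        (by linarith [(hshort x h1).1]) ht)
  have hE : (fun x => (lam : ℂ) * (layer 1 f x + layer (-1) f x) -
      npOperator Ω (fun y => layer 1 f y + layer (-1) f y) x) = packetResidual lam ξ w := by
    ext x; rw [(hNP x).npOperator_eq, packetResidual]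
  have hlow := le_hHalfNorm (Ω := Ω) (φ := fun y => layer 1 f y + layer (-1) f y) (h := 1) (w := w)
      (fun t ht => hseg 1 (Or.inl rfl) t (by linarith)) fun t ht => by
        rw [layer_add_layer_of_long f (Or.inl (horizontal_one 1 t)), horizontal_zero, hf,
          norm_packet]
        exact half_le_tent hw0 ht
  have hpos : 0 < ENNReal.ofReal (w / 4) ^ (1 / 2 : ℝ) :=
    ENNReal.rpow_pos (by rw [ENNReal.ofReal_pos]; positivity) ENNReal.ofReal_ne_top
  have hbd : ∀ x ∈ frontier Ω, ‖packetResidual lam ξ w x‖ ≤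
      residualConst ξ D * w ^ (-(3 / 4) : ℝ) := fun x hx =>
    (hΩ.norm_packetResidual_le hD hshort hw hξ hx).trans <|
      mul_le_mul_of_nonneg_right (by
        have : 0 ≤ |ξ| * stripMoment := by positivity
        rw [residualConst]; linarith) (by positivity)
  have hlip : ∀ x ∈ frontier Ω, ∀ z ∈ frontier Ω,
      ‖packetResidual lam ξ w x - packetResidual lam ξ w z‖ ≤
        residualConst ξ D * w ^ (-(3 / 4) : ℝ) * dist x z := fun x hx z hz =>
    hΩ.norm_packetResidual_sub_le hD hshort hw hξ hx hz
  refine ⟨fun y => layer 1 f y + layer (-1) f y, ⟨?_, (hpos.trans_le hlow).ne',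
    Eventually.of_forall fun x => (hNP x).npExists, ?_⟩, ?_⟩
  · have hL : 0 ≤ |ξ| + 1 / w := by positivity
    refine memHHalf_of_lipschitz (L := 2 * (1 + (|ξ| + 1 / w + 1 / 2))) hΩ.lipschitz
      (fun x _ => ?_) fun x hx z hz => ?_
    · refine (norm_add_le _ _).trans ?_
      linarith [norm_layer_le_one (h := 1) hf1 x, norm_layer_le_one (h := -1) hf1 x]
    · rw [add_sub_add_comm]
      refine (norm_add_le _ _).trans ?_
      have h1 := norm_layer_sub_le two_pos hL hf1 hsupp (norm_packet_sub_le hw0)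
        (hfar 1 (Or.inl rfl)) x hx z hz
      have h2 := norm_layer_sub_le two_pos hL hf1 hsupp (norm_packet_sub_le hw0)
        (hfar (-1) (Or.inr rfl)) x hx z hz
      nlinarith [dist_nonneg (x := x) (y := z)]
  · rw [hE]; exact memHHalf_of_lipschitz hΩ.lipschitz hbd hlip
  · rw [hE]
    have hC : 0 ≤ residualConst ξ D := by rw [residualConst]; positivity
    refine ENNReal.div_le_of_le_mul ((hHalfNorm_le (by positivity) (by linarith) hμ hbd hlip).trans
      (le_trans ?_ (mul_le_mul_right hlow _)))
    rw [ENNReal.ofReal_rpow_of_nonneg (by positivity) (by positivity),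
      ← ENNReal.ofReal_mul (by positivity)]
    refine ENNReal.ofReal_le_ofReal ?_
    have e1 : (w / 4) ^ (1 / 2 : ℝ) = w ^ (1 / 2 : ℝ) / 2 := by
      rw [Real.div_rpow hw0.le (by norm_num), show (4 : ℝ) = 2 ^ (2 : ℝ) by norm_num,
        ← Real.rpow_mul (by norm_num)]
      norm_num
    -- The exponent count: residual `-3/4`, length `1`, packet norm `1/2`, leaving `-1/4`.
    have e2 : w ^ (-(3 / 4) : ℝ) * w = w ^ (-(1 / 4) : ℝ) * w ^ (1 / 2 : ℝ) := by
      nth_rewrite 2 [← Real.rpow_one w]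
      rw [← Real.rpow_add hw0, ← Real.rpow_add hw0]; norm_num
    have e3 : 8 * w + S ≤ (8 + S) * w := by nlinarith
    calc 2 * (residualConst ξ D * w ^ (-(3 / 4) : ℝ)) * (8 * w + S)
        ≤ 2 * (residualConst ξ D * w ^ (-(3 / 4) : ℝ)) * ((8 + S) * w) := by gcongr
      _ = 2 * residualConst ξ D * (8 + S) * (w ^ (-(3 / 4) : ℝ) * w) := by ring
      _ = _ := by rw [e2, e1]; ring

end Quasimode

end ThinNP

/-! ### Assembling the densities and passing to the limit -/

theorem proposition3p1
    (Γl Γr : Set ThinNP.Plane)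
    (hΓl : ThinNP.IsSimpleCurve Γl !₂[0, 1] !₂[0, -1])
    (hΓr : ThinNP.IsSimpleCurve Γr !₂[0, 1] !₂[0, -1])
    (R₀ : ℝ) (hR₀ : 1 ≤ R₀)
    (Ω : ℝ → Set ThinNP.Plane)
    (hΩ : ∀ R : ℝ, R₀ ≤ R → ThinNP.IsThinDomain Γl Γr R (Ω R))
    (lam : ℝ) (hlam : lam ∈ Set.Ioc (0 : ℝ) (1 / 2)) :
    ∃ φ : ℝ → ThinNP.Plane → ℂ,
      (∀ R : ℝ, R₀ ≤ R →
        ThinNP.MemHHalf (Ω R) (φ R) ∧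
        ThinNP.hHalfNorm (Ω R) (φ R) ≠ 0 ∧
        (∀ᵐ x ∂(ThinNP.arcLength (Ω R)), ThinNP.NPExists (Ω R) (φ R) x) ∧
        ThinNP.MemHHalf (Ω R)
          (fun x => (lam : ℂ) * φ R x - ThinNP.npOperator (Ω R) (φ R) x)) ∧
      Tendsto
        (fun R : ℝ =>
          ThinNP.hHalfNorm (Ω R)
              (fun x => (lam : ℂ) * φ R x - ThinNP.npOperator (Ω R) (φ R) x) /
            ThinNP.hHalfNorm (Ω R) (φ R))
        atTop (𝓝 0) := by
  obtain ⟨ξ, hξ⟩ := ThinNP.exists_integral_stripKernel_mul_wave_eq hlam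
  obtain ⟨D, hD, hshort⟩ := ThinNP.exists_shortSides_bound hΓl.isCompact hΓr.isCompact
  obtain ⟨S, hS, hμ⟩ := ThinNP.exists_hausdorffMeasure_frontier_le (hΩ R₀ le_rfl)
  set C := 4 * ThinNP.residualConst ξ D * (8 + S) with hC
  have key : ∀ R : ℝ, ∃ φ : ThinNP.Plane → ℂ, R₀ ≤ R → ThinNP.IsAdmissible (Ω R) lam φ ∧
      (4 * D + 8 ≤ R →
        ThinNP.hHalfNorm (Ω R) (fun x => (lam : ℂ) * φ x - ThinNP.npOperator (Ω R) φ x) /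
          ThinNP.hHalfNorm (Ω R) φ ≤ ENNReal.ofReal (C * (R / 2) ^ (-(1 / 4) : ℝ))) := fun R => by
    by_cases hR : R₀ ≤ R
    -- With `R = 2w` this is the condition `2 * D + 4 ≤ w` of the quasimode construction; smaller
    -- `R` need only admissibility, since they do not affect the limit.
    · by_cases hR' : 4 * D + 8 ≤ R
      · obtain ⟨w, rfl⟩ : ∃ w, R = 2 * w := ⟨R / 2, by ring⟩
        have h1 := hμ _ _ (by linarith) (hΩ _ hR)
        rw [show 4 * (2 * w) = 8 * w by ring] at h1
        obtain ⟨φ, hφ, hφ'⟩ := (hΩ _ hR).exists_quasimode hD hS (hshort _) (by linarith) hξ h1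
        exact ⟨φ, fun _ => ⟨hφ, fun _ => by rwa [mul_div_cancel_left₀ w two_ne_zero]⟩⟩
      · obtain ⟨φ, hφ⟩ := (hΩ R hR).exists_isAdmissible hΓl.isCompact hΓr.isCompact
          (hR₀.trans hR) lam
        exact ⟨φ, fun _ => ⟨hφ, fun h => absurd h hR'⟩⟩
    · exact ⟨0, fun h => absurd h hR⟩
  choose φ hφ using key
  refine ⟨φ, fun R hR => (hφ R hR).1, ?_⟩
  have hlim : Tendsto (fun R : ℝ => ENNReal.ofReal (C * (R / 2) ^ (-(1 / 4) : ℝ))) atTop (𝓝 0) := by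
    have h1 : Tendsto (fun R : ℝ => (R / 2) ^ (-(1 / 4) : ℝ)) atTop (𝓝 0) :=
      (tendsto_rpow_neg_atTop (by norm_num)).comp (tendsto_id.atTop_div_const two_pos)
    have h2 := ENNReal.tendsto_ofReal (h1.const_mul C)
    rwa [mul_zero, ENNReal.ofReal_zero] at h2
  refine tendsto_of_tendsto_of_tendsto_of_le_of_le' tendsto_const_nhds hlim
    (Eventually.of_forall fun _ => zero_le) ?_
  filter_upwards [eventually_ge_atTop R₀, eventually_ge_atTop (4 * D + 8)] with R hR hR'
  exact (hφ R hR).2 hR'
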